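/- Let $k$ be a field of characteristic different from $2$, let $A = k\langle u,v\rangle/(vu-uv+v^2)$ be the Jordan plane, and let $C_2=\langle g \mid g^2=1\rangle$ act on $A$ by algebra automorphisms with $g\cdot u=-u$, $g\cdot v=-v$. Give $A\otimes A^{\mathrm{op}}$ (ordinary tensor product over $k$ with the ordinary opposite algebra, which corresponds to the trivial braiding) the diagonal $C_2$-action and write $u,v,u',v'$ for $u\otimes 1,\ v\otimes 1,\ 1\otimes u,\ 1\otimes v$. (1) $A\otimes A^{\mathrm{op}}$ is the algebra generated by $u,v,u',v'$ subject to the relations $r_1=\dots=r_6=0$, where $$r_1=vu-uv+v^2,\quad r_2=v'u'-u'v'-v'^2,\quad r_3=uu'-u'u,\quad r_4=vu'-u'v,\quad r_5=uv'-v'u,\quad r_6=vv'-v'v .$$ (2) Let $I$ be the span of $r_1,\dots,r_6$ in the free algebra $k\langle u,v,u',v'\rangle$, on which $g$ acts by $-1$ on each of the four letters. For a $k$-linear map $\kappa: I\to kC_2$ let $$\mathcal D_\kappa=\frac{k\langle u,v,u',v'\rangle\# kC_2}{(r-\kappa(r) : r\in I)},$$ filtered by giving $kC_2$ degree $0$ and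 $u,v,u',v'$ degree $1$. Grade $(A\otimes A^{\mathrm{op}})\# kC_2$ in the same way. Call $\mathcal D_\kappa$ a PBW deformation of $(A\otimes A^{\mathrm{op}})\# kC_2$ (of degree $0$) if its associated graded algebra is isomorphic to $(A\otimes A^{\mathrm{op}})\# kC_2$ as an $\mathbb N$-graded algebra. Then for all $\alpha_1,\alpha_2,\alpha_3\in k$ there is exactly one linear map $\kappa:I\to kC_2$ with $$\kappa(r_i)=\alpha_i \ (i=1,2,3),\qquad \kappa(r_j)=0\ (j=4,5,6),$$ and for an arbitrary linear map $\kappa: I\to kC_2$, the algebra $\mathcal D_\kappa$ is a PBW deformation of $(A\otimes A^{\mathrm{op}})\# kC_2$ if and only if $\kappa$ is of this form for some $\alpha_1,\alpha_2,\alpha_3\in k$. -/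

import Mathlib

open scoped TensorProduct

noncomputable section

namespace JordanPBW

/-! ### Filtered algebras and PBW deformations -/

/-- An exhaustive increasing filtration `F 0 ⊆ F 1 ⊆ ⋯` of a `k`-algebra `D` by subspaces with
`1 ∈ F 0` and `F i * F j ⊆ F (i + j)`. -/
structure AlgFiltration (k D : Type*) [CommRing k] [Ring D] [Algebra k D] where
  F : ℕ → Submodule k D
  mono : Monotone F
  one_mem : (1 : D) ∈ F 0
  mul_mem : ∀ {i j : ℕ} {x y : D}, x ∈ F i → y ∈ F j → x * y ∈ F (i + j)
  exhaustive : ⨆ i, F i = ⊤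

namespace AlgFiltration

variable {k D : Type*} [CommRing k] [Ring D] [Algebra k D] (Φ : AlgFiltration k D)

/-- The step `F (n - 1)`, with the convention `F (-1) = 0`. -/
def prev : ℕ → Submodule k D
  | 0 => ⊥
  | n + 1 => Φ.F n

/-- The degree `n` part `F n / F (n - 1)` of the associated graded algebra. -/
abbrev Gr (n : ℕ) : Type _ := Φ.F n ⧸ (Φ.prev n).submoduleOf (Φ.F n)

/-- The class in `F n / F (n - 1)` of an element `x` of `F n`. The multiplication of the
associated graded algebra is given by `symb x * symb y = symb (x * y)`, and its unit is
`symb 1`. -/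
def symb {n : ℕ} (x : D) (hx : x ∈ Φ.F n) : Φ.Gr n :=
  Submodule.Quotient.mk ⟨x, hx⟩

end AlgFiltration

/-- `𝒜` makes `R` an `ℕ`-graded `k`-algebra: `1 ∈ R₀`, `Rᵢ Rⱼ ⊆ Rᵢ₊ⱼ`, and `R` is the direct sum
of the `Rᵢ`. -/
def IsAlgGrading {k R : Type*} [CommRing k] [Ring R] [Algebra k R]
    (𝒜 : ℕ → Submodule k R) : Prop :=
  SetLike.GradedMonoid 𝒜 ∧ DirectSum.IsInternal 𝒜

/-- The filtered algebra `(D, Φ)` is a PBW deformation of the `ℕ`-graded algebra `(R, 𝒜)`: the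
associated graded algebra `⨁ F n / F (n - 1)` is isomorphic to `R = ⨁ 𝒜 n` as an `ℕ`-graded
algebra. The isomorphism is given by its homogeneous components
`e n : F n / F (n - 1) ≃ 𝒜 n`, which have to respect units and products. -/
def IsPBWDeformation {k D R : Type*} [CommRing k] [Ring D] [Algebra k D] [Ring R] [Algebra k R]
    (Φ : AlgFiltration k D) (𝒜 : ℕ → Submodule k R) : Prop :=
  IsAlgGrading 𝒜 ∧
  ∃ e : ∀ n, Φ.Gr n ≃ₗ[k] 𝒜 n,
    ((e 0 (Φ.symb 1 Φ.one_mem) : 𝒜 0) : R) = 1 ∧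
    ∀ (i j : ℕ) (x y : D) (hx : x ∈ Φ.F i) (hy : y ∈ Φ.F j),
      ((e (i + j) (Φ.symb (x * y) (Φ.mul_mem hx hy)) : 𝒜 (i + j)) : R) =
        ((e i (Φ.symb x hx) : 𝒜 i) : R) * ((e j (Φ.symb y hy) : 𝒜 j) : R)

/-! ### The group `C₂` and its sign character -/

/-- The cyclic group of order two, written multiplicatively. -/
abbrev C2 : Type := Multiplicative (ZMod 2)

/-- The character `1 ↦ 1`, `g ↦ -1` of `C₂`. -/
def sgn (k : Type*) [CommRing k] : C2 →* k where
  toFun g := if g = 1 then 1 else -1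
  map_one' := by simp
  map_mul' a b := by
    have h : ∀ a b : C2, (a = 1 ∧ b = 1 ∧ a * b = 1) ∨ (a = 1 ∧ b ≠ 1 ∧ a * b ≠ 1) ∨
        (a ≠ 1 ∧ b = 1 ∧ a * b ≠ 1) ∨ (a ≠ 1 ∧ b ≠ 1 ∧ a * b = 1) := by decide
    rcases h a b with ⟨h1, h2, h3⟩ | ⟨h1, h2, h3⟩ | ⟨h1, h2, h3⟩ | ⟨h1, h2, h3⟩
    · rw [if_pos h1, if_pos h2, if_pos h3, one_mul]
    · rw [if_pos h1, if_neg h2, if_neg h3, one_mul]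
    · rw [if_neg h1, if_pos h2, if_neg h3, mul_one]
    · rw [if_neg h1, if_neg h2, if_pos h3, neg_mul_neg, one_mul]

/-- The algebra endomorphism of a free algebra that multiplies each generator by `c`. -/
def freeScale (k X : Type*) [CommRing k] (c : k) : FreeAlgebra k X →ₐ[k] FreeAlgebra k X :=
  FreeAlgebra.lift k (fun x => c • FreeAlgebra.ι k x)

@[simp] theorem freeScale_ι (k X : Type*) [CommRing k] (c : k) (x : X) :
    freeScale k X c (FreeAlgebra.ι k x) = c • FreeAlgebra.ι k x := by
  simp [freeScale]

/-! ### The Jordan plane -/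

/-- The two generators of the Jordan plane. -/
inductive Gen2
  | u
  | v

/-- The defining relation `vu - uv + v²` of the Jordan plane. -/
inductive JordanRel (k : Type*) [CommRing k] :
    FreeAlgebra k Gen2 → FreeAlgebra k Gen2 → Prop
  | rel : JordanRel k
      (FreeAlgebra.ι k Gen2.v * FreeAlgebra.ι k Gen2.u
        - FreeAlgebra.ι k Gen2.u * FreeAlgebra.ι k Gen2.v
        + FreeAlgebra.ι k Gen2.v ^ 2) 0

/-- The Jordan plane `k⟨u, v⟩ / (vu - uv + v²)`. -/
def JordanPlane (k : Type*) [CommRing k] : Type _ := RingQuot (JordanRel k)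

instance (k : Type*) [CommRing k] : Ring (JordanPlane k) := inferInstanceAs (Ring (RingQuot (JordanRel k)))

instance (k : Type*) [CommRing k] : Algebra k (JordanPlane k) :=
  inferInstanceAs (Algebra k (RingQuot (JordanRel k)))

/-- The quotient map onto the Jordan plane. -/
def jmk (k : Type*) [CommRing k] : FreeAlgebra k Gen2 →ₐ[k] JordanPlane k :=
  RingQuot.mkAlgHom k (JordanRel k)

/-- The generators `u`, `v` of the Jordan plane. -/
def jgen (k : Type*) [CommRing k] (x : Gen2) : JordanPlane k :=
  jmk k (FreeAlgebra.ι k x)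

theorem jgen_rel (k : Type*) [CommRing k] :
    jgen k Gen2.v * jgen k Gen2.u - jgen k Gen2.u * jgen k Gen2.v + jgen k Gen2.v ^ 2 = 0 := by
  have h : jmk k _ = jmk k _ := RingQuot.mkAlgHom_rel k (JordanRel.rel (k := k))
  simpa [jgen] using h

/-- The universal property of the Jordan plane. -/
def jlift (k : Type*) [CommRing k] {B : Type*} [Ring B] [Algebra k B]
    (f : FreeAlgebra k Gen2 →ₐ[k] B)
    (hf : f (FreeAlgebra.ι k Gen2.v * FreeAlgebra.ι k Gen2.u
      - FreeAlgebra.ι k Gen2.u * FreeAlgebra.ι k Gen2.v + FreeAlgebra.ι k Gen2.v ^ 2) = 0) :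
    JordanPlane k →ₐ[k] B :=
  RingQuot.liftAlgHom k ⟨f, by rintro _ _ ⟨⟩; rw [hf, map_zero]⟩

@[simp] theorem jlift_jmk (k : Type*) [CommRing k] {B : Type*} [Ring B] [Algebra k B]
    (f : FreeAlgebra k Gen2 →ₐ[k] B) (hf) (x : FreeAlgebra k Gen2) :
    jlift k f hf (jmk k x) = f x :=
  RingQuot.liftAlgHom_mkAlgHom_apply k f _ x

theorem jordan_hom_ext (k : Type*) [CommRing k] {B : Type*} [Ring B] [Algebra k B]
    {f g : JordanPlane k →ₐ[k] B} (h : ∀ x, f (jgen k x) = g (jgen k x)) : f = g := by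
  apply RingQuot.ringQuot_ext'
  apply FreeAlgebra.hom_ext
  funext x
  exact h x

/-- The algebra endomorphism of the Jordan plane that multiplies `u` and `v` by `c`. -/
def jordanScale (k : Type*) [CommRing k] (c : k) : JordanPlane k →ₐ[k] JordanPlane k :=
  jlift k (FreeAlgebra.lift k (fun x => c • jgen k x)) (by
    have h := congrArg (fun z => (c * c) • z) (jgen_rel k)
    simpa [smul_add, smul_sub, pow_two, smul_smul] using h)

@[simp] theorem jordanScale_jgen (k : Type*) [CommRing k] (c : k) (x : Gen2) :
    jordanScale k c (jgen k x) = c • jgen k x := by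
  rw [jordanScale, jgen, jlift_jmk, FreeAlgebra.lift_ι_apply, jgen]

/-! ### The algebra `A ⊗ Aᵒᵖ` and its `C₂`-action -/

/-- `A ⊗ Aᵒᵖ` for the Jordan plane `A`. -/
abbrev Env (k : Type*) [CommRing k] : Type _ := JordanPlane k ⊗[k] (JordanPlane k)ᵐᵒᵖ

/-- The four letters `u, v, u', v'`. -/
inductive Gen4
  | u
  | v
  | u'
  | v'

/-- The elements `u ⊗ 1`, `v ⊗ 1`, `1 ⊗ u`, `1 ⊗ v` of `A ⊗ Aᵒᵖ` named by the four letters. -/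
def envGen (k : Type*) [CommRing k] : Gen4 → Env k
  | Gen4.u => jgen k Gen2.u ⊗ₜ[k] 1
  | Gen4.v => jgen k Gen2.v ⊗ₜ[k] 1
  | Gen4.u' => 1 ⊗ₜ[k] MulOpposite.op (jgen k Gen2.u)
  | Gen4.v' => 1 ⊗ₜ[k] MulOpposite.op (jgen k Gen2.v)

/-- The diagonal action of a scalar `c` on `A ⊗ Aᵒᵖ`, for the action on `A` (and on its copy
`Aᵒᵖ`) that multiplies `u` and `v` by `c`. -/
def envScale (k : Type*) [CommRing k] (c : k) : Env k →ₐ[k] Env k :=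
  Algebra.TensorProduct.map (jordanScale k c) (AlgHom.op (jordanScale k c))

theorem jordanScale_one (k : Type*) [CommRing k] :
    jordanScale k 1 = AlgHom.id k (JordanPlane k) :=
  jordan_hom_ext k fun x => by simp

theorem jordanScale_mul (k : Type*) [CommRing k] (c d : k) :
    jordanScale k (c * d) = (jordanScale k c).comp (jordanScale k d) :=
  jordan_hom_ext k fun x => by simp [smul_smul, mul_comm]

theorem envScale_one (k : Type*) [CommRing k] (x : Env k) : envScale k 1 x = x := by
  have : envScale k 1 = AlgHom.id k (Env k) := by
    apply Algebra.TensorProduct.ext'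
    intro a b
    simp [envScale, jordanScale_one]
  simp [this]

theorem envScale_mul (k : Type*) [CommRing k] (c d : k) (x : Env k) :
    envScale k (c * d) x = envScale k c (envScale k d x) := by
  have : envScale k (c * d) = (envScale k c).comp (envScale k d) := by
    apply Algebra.TensorProduct.ext'
    intro a b
    simp [envScale, jordanScale_mul]
  simp [this]

/-- The diagonal action of `C₂` on `A ⊗ Aᵒᵖ`, where the generator `g` acts on `A` (and on `Aᵒᵖ`)
by the algebra automorphism `u ↦ -u`, `v ↦ -v`. -/
instance (k : Type*) [CommRing k] : MulSemiringAction C2 (Env k) where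
  smul g x := envScale k (sgn k g) x
  one_smul x := by
    change envScale k (sgn k 1) x = x
    rw [map_one, envScale_one]
  mul_smul g h x := by
    change envScale k (sgn k (g * h)) x = envScale k (sgn k g) (envScale k (sgn k h) x)
    rw [map_mul, envScale_mul]
  smul_zero g := map_zero (envScale k (sgn k g))
  smul_add g := map_add (envScale k (sgn k g))
  smul_one g := map_one (envScale k (sgn k g))
  smul_mul g := map_mul (envScale k (sgn k g))

instance (k : Type*) [CommRing k] : SMulCommClass C2 k (Env k) where
  smul_comm g c x := map_smul (envScale k (sgn k g)) c x

/-! ### The free algebra `k⟨u, v, u', v'⟩` and its `C₂`-action -/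

/-- The free algebra `k⟨u, v, u', v'⟩`, that is, the tensor algebra of the vector space `W` with
basis `u, v, u', v'`. -/
abbrev Free4 (k : Type*) [CommRing k] : Type _ := FreeAlgebra k Gen4

theorem freeScale_one (k X : Type*) [CommRing k] (x : FreeAlgebra k X) :
    freeScale k X 1 x = x := by
  have : freeScale k X 1 = AlgHom.id k (FreeAlgebra k X) := by
    apply FreeAlgebra.hom_ext
    funext y
    simp
  simp [this]

theorem freeScale_mul (k X : Type*) [CommRing k] (c d : k) (x : FreeAlgebra k X) :
    freeScale k X (c * d) x = freeScale k X c (freeScale k X d x) := by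
  have : freeScale k X (c * d) = (freeScale k X c).comp (freeScale k X d) := by
    apply FreeAlgebra.hom_ext
    funext y
    simp [smul_smul, mul_comm]
  simp [this]

/-- The action of `C₂` on `k⟨u, v, u', v'⟩` by algebra automorphisms, where the generator `g`
multiplies each of the four letters by `-1`. -/
instance (k : Type*) [CommRing k] : MulSemiringAction C2 (Free4 k) where
  smul g x := freeScale k Gen4 (sgn k g) x
  one_smul x := by
    change freeScale k Gen4 (sgn k 1) x = x
    rw [map_one, freeScale_one]
  mul_smul g h x := by
    change freeScale k Gen4 (sgn k (g * h)) x =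
      freeScale k Gen4 (sgn k g) (freeScale k Gen4 (sgn k h) x)
    rw [map_mul, freeScale_mul]
  smul_zero g := map_zero (freeScale k Gen4 (sgn k g))
  smul_add g := map_add (freeScale k Gen4 (sgn k g))
  smul_one g := map_one (freeScale k Gen4 (sgn k g))
  smul_mul g := map_mul (freeScale k Gen4 (sgn k g))

instance (k : Type*) [CommRing k] : SMulCommClass C2 k (Free4 k) where
  smul_comm g c x := map_smul (freeScale k Gen4 (sgn k g)) c x

theorem smul_free_def (k : Type*) [CommRing k] (g : C2) (x : Free4 k) :
    g • x = freeScale k Gen4 (sgn k g) x := rfl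

/-! ### The relations of `A ⊗ Aᵒᵖ` -/

/-- The six relations
`r₁ = vu - uv + v²`, `r₂ = v'u' - u'v' - v'²`, `r₃ = uu' - u'u`,
`r₄ = vu' - u'v`, `r₅ = uv' - v'u`, `r₆ = vv' - v'v`, indexed by `0, …, 5`. -/
def rel (k : Type*) [CommRing k] : Fin 6 → Free4 k :=
  let u := FreeAlgebra.ι k Gen4.u
  let v := FreeAlgebra.ι k Gen4.v
  let u' := FreeAlgebra.ι k Gen4.u'
  let v' := FreeAlgebra.ι k Gen4.v'
  ![v * u - u * v + v ^ 2,
    v' * u' - u' * v' - v' ^ 2,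
    u * u' - u' * u,
    v * u' - u' * v,
    u * v' - v' * u,
    v * v' - v' * v]

/-- The relation on `k⟨u, v, u', v'⟩` that sets `r₁, …, r₆` to zero. -/
def PresRel (k : Type*) [CommRing k] (x y : Free4 k) : Prop :=
  (∃ i : Fin 6, x = rel k i) ∧ y = 0

/-- The algebra `k⟨u, v, u', v'⟩ / (r₁, …, r₆)`. -/
def Presented (k : Type*) [CommRing k] : Type _ := RingQuot (PresRel k)

instance (k : Type*) [CommRing k] : Ring (Presented k) := inferInstanceAs (Ring (RingQuot (PresRel k)))

instance (k : Type*) [CommRing k] : Algebra k (Presented k) :=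
  inferInstanceAs (Algebra k (RingQuot (PresRel k)))

/-- The quotient map onto `k⟨u, v, u', v'⟩ / (r₁, …, r₆)`. -/
def presMk (k : Type*) [CommRing k] : Free4 k →ₐ[k] Presented k :=
  RingQuot.mkAlgHom k (PresRel k)

/-- The class of a letter in `k⟨u, v, u', v'⟩ / (r₁, …, r₆)`. -/
def presGen (k : Type*) [CommRing k] (x : Gen4) : Presented k :=
  presMk k (FreeAlgebra.ι k x)

/-- The space `I ⊆ W ⊗ W` of quadratic relations, spanned by `r₁, …, r₆`. -/
def relSpace (k : Type*) [CommRing k] : Submodule k (Free4 k) :=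
  Submodule.span k (Set.range (rel k))

/-- `rᵢ` as an element of `I`. -/
def relI (k : Type*) [CommRing k] (i : Fin 6) : relSpace k :=
  ⟨rel k i, Submodule.subset_span ⟨i, rfl⟩⟩

/-! ### Smash products with `kC₂`

For a `k`-algebra `B` on which `C₂` acts by algebra automorphisms, the smash product `B # kC₂` is
the skew group algebra `SkewMonoidAlgebra B C2`, in which `single g b` stands for `b # g`; the
product is `(b # g) (b' # g') = b (g • b') # g g'`. -/

/-- The smash product `B # kC₂`. -/
abbrev Smash (B : Type*) [Ring B] : Type _ := SkewMonoidAlgebra B C2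

/-- The subspace of `B # kC₂` spanned by the `b # g` with `b` in the subspace `S` of `B`. -/
def smashSub {k B : Type*} [CommRing k] [Ring B] [Algebra k B] (S : Submodule k B) :
    Submodule k (Smash B) where
  carrier := {x | ∀ g, x.coeff g ∈ S}
  zero_mem' g := by simp
  add_mem' hx hy g := by simpa using S.add_mem (hx g) (hy g)
  smul_mem' c x hx g := by simpa using S.smul_mem c (hx g)

/-- The grading of `A ⊗ Aᵒᵖ` with the four generators in degree one: the degree `n` part is
spanned by the words of length `n` in the generators. -/
def envDeg (k : Type*) [CommRing k] (n : ℕ) : Submodule k (Env k) :=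
  Submodule.span k (Set.range (envGen k)) ^ n

/-- The grading of `(A ⊗ Aᵒᵖ) # kC₂` with `kC₂` in degree zero. -/
def smashDeg (k : Type*) [CommRing k] (n : ℕ) : Submodule k (Smash (Env k)) :=
  smashSub (envDeg k n)

/-- The elements of `k⟨u, v, u', v'⟩` of degree at most `n`: the span of all products of `n`
factors from `k ⊕ W`. -/
def freeLE (k : Type*) [CommRing k] (n : ℕ) : Submodule k (Free4 k) :=
  (1 ⊔ Submodule.span k (Set.range (FreeAlgebra.ι k : Gen4 → Free4 k))) ^ n

/-! ### The algebras `D_κ` -/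

/-- The embedding `b ↦ b # 1` of `k⟨u, v, u', v'⟩` into `k⟨u, v, u', v'⟩ # kC₂`. -/
def inclFree (k : Type*) [CommRing k] : Free4 k →+* Smash (Free4 k) :=
  SkewMonoidAlgebra.singleOneRingHom

/-- The embedding `h ↦ 1 # h` of the group algebra `kC₂` into `k⟨u, v, u', v'⟩ # kC₂`. -/
def inclGroup (k : Type*) [CommRing k] :
    MonoidAlgebra k C2 →ₐ[k] Smash (Free4 k) :=
  MonoidAlgebra.lift k (Smash (Free4 k)) C2 (SkewMonoidAlgebra.of (Free4 k) C2)

/-- The relation that identifies `r` with `κ(r)` for all `r ∈ I`. -/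
def DefRel (k : Type*) [CommRing k] (κ : relSpace k →ₗ[k] MonoidAlgebra k C2)
    (x y : Smash (Free4 k)) : Prop :=
  ∃ r : relSpace k, x = inclFree k (r : Free4 k) ∧ y = inclGroup k (κ r)

/-- `D_κ = (k⟨u, v, u', v'⟩ # kC₂) / (r - κ(r) : r ∈ I)`. -/
def DefAlg (k : Type*) [CommRing k] (κ : relSpace k →ₗ[k] MonoidAlgebra k C2) : Type _ :=
  RingQuot (DefRel k κ)

instance (k : Type*) [CommRing k] (κ : relSpace k →ₗ[k] MonoidAlgebra k C2) :
    Ring (DefAlg k κ) :=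
  inferInstanceAs (Ring (RingQuot (DefRel k κ)))

instance (k : Type*) [CommRing k] (κ : relSpace k →ₗ[k] MonoidAlgebra k C2) :
    Algebra k (DefAlg k κ) :=
  inferInstanceAs (Algebra k (RingQuot (DefRel k κ)))

/-- The quotient map onto `D_κ`. -/
def defMk (k : Type*) [CommRing k] (κ : relSpace k →ₗ[k] MonoidAlgebra k C2) :
    Smash (Free4 k) →ₐ[k] DefAlg k κ :=
  RingQuot.mkAlgHom k (DefRel k κ)

theorem defMk_surjective (k : Type*) [CommRing k]
    (κ : relSpace k →ₗ[k] MonoidAlgebra k C2) : Function.Surjective (defMk k κ) :=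
  RingQuot.mkAlgHom_surjective k (DefRel k κ)

theorem smul_mem_freeLE (k : Type*) [CommRing k] (g : C2) (n : ℕ) {x : Free4 k}
    (hx : x ∈ freeLE k n) : g • x ∈ freeLE k n := by
  have h : (freeLE k n).map (freeScale k Gen4 (sgn k g)).toLinearMap ≤ freeLE k n := by
    unfold freeLE
    rw [Submodule.map_pow]
    refine pow_le_pow_left' ?_ n
    rw [Submodule.map_sup, Submodule.map_one, Submodule.map_span]
    refine sup_le_sup_left ?_ _
    rw [Submodule.span_le]
    rintro _ ⟨_, ⟨y, rfl⟩, rfl⟩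
    simp only [AlgHom.toLinearMap_apply, freeScale_ι]
    exact Submodule.smul_mem _ _ (Submodule.subset_span ⟨y, rfl⟩)
  exact h ⟨x, hx, rfl⟩

theorem freeLE_mono (k : Type*) [CommRing k] : Monotone (freeLE k) := fun _ _ h =>
  pow_le_pow_right' (le_sup_left : (1 : Submodule k (Free4 k)) ≤ _) h

theorem freeLE_mul {k : Type*} [CommRing k] {i j : ℕ} {x y : Free4 k}
    (hx : x ∈ freeLE k i) (hy : y ∈ freeLE k j) : x * y ∈ freeLE k (i + j) := by
  unfold freeLE at *
  rw [pow_add]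
  exact Submodule.mul_mem_mul hx hy

theorem exists_mem_freeLE (k : Type*) [CommRing k] (x : Free4 k) : ∃ n, x ∈ freeLE k n := by
  induction x using FreeAlgebra.induction with
  | grade0 r =>
    refine ⟨0, ?_⟩
    simp [freeLE, Submodule.mem_one]
  | grade1 x =>
    refine ⟨1, ?_⟩
    rw [freeLE, pow_one]
    exact Submodule.mem_sup_right (Submodule.subset_span ⟨x, rfl⟩)
  | mul a b ha hb =>
    obtain ⟨n, hn⟩ := ha
    obtain ⟨m, hm⟩ := hb
    exact ⟨n + m, freeLE_mul hn hm⟩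
  | add a b ha hb =>
    obtain ⟨n, hn⟩ := ha
    obtain ⟨m, hm⟩ := hb
    exact ⟨max n m, add_mem (freeLE_mono k (le_max_left _ _) hn)
      (freeLE_mono k (le_max_right _ _) hm)⟩

theorem smashSub_mul {k : Type*} [CommRing k] {i j : ℕ}
    {x y : Smash (Free4 k)}
    (hx : x ∈ smashSub (freeLE k i)) (hy : y ∈ smashSub (freeLE k j)) :
    x * y ∈ smashSub (freeLE k (i + j)) := by
  intro g
  rw [SkewMonoidAlgebra.coeff_mul]
  refine Submodule.sum_mem _ fun a _ => Submodule.sum_mem _ fun b _ => ?_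
  dsimp only
  split_ifs
  · exact freeLE_mul (hx a) (smul_mem_freeLE k a j (hy b))
  · exact Submodule.zero_mem _

/-- The filtration of `D_κ` with `kC₂` in degree zero and `u, v, u', v'` in degree one: its
`n`-th step is the image of the span of all `b # g` with `b` of degree at most `n`. -/
def defFiltration (k : Type*) [CommRing k] (κ : relSpace k →ₗ[k] MonoidAlgebra k C2) :
    AlgFiltration k (DefAlg k κ) where
  F n := (smashSub (freeLE k n)).map (defMk k κ).toLinearMap
  mono i j h := Submodule.map_mono fun x hx g => freeLE_mono k h (hx g)
  one_mem := by
    refine ⟨1, fun g => ?_, by simp⟩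
    rw [SkewMonoidAlgebra.coeff_one, Finsupp.single_apply]
    split_ifs <;> simp [freeLE]
  mul_mem := by
    rintro i j _ _ ⟨x, hx, rfl⟩ ⟨y, hy, rfl⟩
    exact ⟨x * y, smashSub_mul hx hy, by simp⟩
  exhaustive := by
    rw [eq_top_iff]
    rintro y -
    obtain ⟨x, rfl⟩ := defMk_surjective k κ y
    choose N hN using fun g => exists_mem_freeLE k (x.coeff g)
    refine Submodule.mem_iSup_of_mem (Finset.univ.sup N) ⟨x, fun g => ?_, rfl⟩
    exact freeLE_mono k (Finset.le_sup (Finset.mem_univ g)) (hN g)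

end JordanPBW

end

noncomputable section

namespace JordanPBW

open MvPolynomial

section CommRing

/-! ### A differential operator representation -/

/-! Sufficiency rests on an explicit model. For scalars `a`, the letters act on polynomials in four
commuting variables: `v`, `v'` by multiplication, `u` by `X_u + (X_v² - a₀)∂_v`, and `u'` by `X_u' -
(X_v'² + a₁)∂_v' - a₂∂_u`. The six relations then act as the scalars `a₀, a₁, a₂, 0, 0, 0`
(`rep_rel`). Let `ev a x` be the result of applying `x` to the polynomial `1`. Wherever the deformed
relations hold, ordered words span, and the coefficients of the normal form of `x` are those of `ev
a x` (`map_sec_ev`). So the kernel of `ev a` is exactly the ideal of the deformed relations. For `a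
= 0` this describes `A ⊗ Aᵒᵖ` (`envHom_eq_zero_iff`); inducing the model to functions on `C₂`
describes `D_κ` (`defMk_eq_zero_iff`).

On words of length `n`, `ev 0` is homogeneous of degree `n`, while `ev a - ev 0` has degree below
`n`. Hence a combination of such words, with coefficients in `kC₂`, has zero symbol in `gr D_κ`
exactly when it vanishes in `(A ⊗ Aᵒᵖ) # kC₂` (`toGr_eq_zero_iff_toSmashDeg_eq_zero`). Both graded
pieces are thus the same quotient of the same space, compatibly with products.

Conversely, a dimension count in degree one shows that in a PBW deformation no nonzero combination
of letters with coefficients in `kC₂` dies in `D_κ` (`toGr_one_injective`). Each syzygy `∑ rᵢ cᵢ = ∑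
dᵢ rᵢ` with linear `cᵢ, dᵢ` then forces `∑ (κ(rᵢ) cᵢ - dᵢ κ(rᵢ)) = 0` (`overlap_condition`). Three
syzygies suffice to kill every component of `κ` except the identity components on `r₁, r₂, r₃`
(`kappa_conditions`); this is where `2 ≠ 0` enters. -/

instance : DecidableEq Gen4 := fun a b => by
  cases a <;> cases b <;> first | exact isTrue rfl | exact isFalse (by rintro ⟨⟩)

/-- The polynomial ring in four commuting letters. -/
abbrev Poly4 (k : Type*) [CommRing k] : Type _ := MvPolynomial Gen4 k

/-- The commutator of two derivations is a derivation, and this one kills every variable. -/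
theorem pderiv_pderiv_comm {k σ : Type*} [CommRing k] (i j : σ) (p : MvPolynomial σ k) :
    pderiv i (pderiv j p) = pderiv j (pderiv i p) := by
  classical
  have h : ⁅pderiv i, pderiv j⁆ = (0 : Derivation k (MvPolynomial σ k) (MvPolynomial σ k)) :=
    MvPolynomial.derivation_ext fun l => by
      rw [Derivation.commutator_apply]
      simp [pderiv_X, Pi.single_apply, apply_ite]
  have h' := congrArg (fun D => D p) h
  rw [Derivation.commutator_apply] at h'
  exact sub_eq_zero.mp h'

/-- The scalars `(a₀, a₁, a₂, 0, 0, 0)` to which the six relations are deformed. -/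
def shift {k : Type*} [CommRing k] (a : Fin 3 → k) : Fin 6 → k := ![a 0, a 1, a 2, 0, 0, 0]

variable {k : Type*} [CommRing k]

/-- The operators on polynomials by which the four letters act. -/
def opGen (a : Fin 3 → k) : Gen4 → Module.End k (Poly4 k)
  | Gen4.u => LinearMap.mulLeft k (X Gen4.u) +
      LinearMap.mulLeft k (X Gen4.v ^ 2 - C (a 0)) ∘ₗ (pderiv Gen4.v).toLinearMap
  | Gen4.v => LinearMap.mulLeft k (X Gen4.v)
  | Gen4.u' => LinearMap.mulLeft k (X Gen4.u') -
      LinearMap.mulLeft k (X Gen4.v' ^ 2 + C (a 1)) ∘ₗ (pderiv Gen4.v').toLinearMap -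
      a 2 • (pderiv Gen4.u).toLinearMap
  | Gen4.v' => LinearMap.mulLeft k (X Gen4.v')

theorem opGen_u (a : Fin 3 → k) (p : Poly4 k) : opGen a Gen4.u p =
    X Gen4.u * p + (X Gen4.v ^ 2 - C (a 0)) * pderiv Gen4.v p := rfl

theorem opGen_v (a : Fin 3 → k) (p : Poly4 k) : opGen a Gen4.v p = X Gen4.v * p := rfl

theorem opGen_u' (a : Fin 3 → k) (p : Poly4 k) : opGen a Gen4.u' p =
    X Gen4.u' * p - (X Gen4.v' ^ 2 + C (a 1)) * pderiv Gen4.v' p - a 2 • pderiv Gen4.u p := rfl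

theorem opGen_v' (a : Fin 3 → k) (p : Poly4 k) : opGen a Gen4.v' p = X Gen4.v' * p := rfl

/-- The representation of the free algebra on polynomials in which the six relations act as the
scalars `shift a`. -/
def rep (a : Fin 3 → k) : Free4 k →ₐ[k] Module.End k (Poly4 k) := FreeAlgebra.lift k (opGen a)

@[simp] theorem rep_ι (a : Fin 3 → k) (x : Gen4) : rep a (FreeAlgebra.ι k x) = opGen a x :=
  FreeAlgebra.lift_ι_apply _ _

/-- The only nonzero commutators of the four operators are `[u, v] = v² - a₀`, `[u', v'] = -(v'² +
a₁)` and `[u', u] = -a₂`. -/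
theorem rep_rel (a : Fin 3 → k) (i : Fin 6) :
    rep a (rel k i) = algebraMap k _ (shift a i) := by
  refine LinearMap.ext fun p => ?_
  fin_cases i <;>
  simp [rel, shift, opGen_u, opGen_v, opGen_u', opGen_v', Derivation.leibniz, pderiv_X,
    pow_two, Module.algebraMap_end_apply, MvPolynomial.smul_eq_C_mul] <;>
  try simp only [pderiv_pderiv_comm Gen4.u Gen4.v, pderiv_pderiv_comm Gen4.v' Gen4.v]
  all_goals ring

/-! ### Evaluation at `1` and ordered words -/

/-- The action of an element of the free algebra on the polynomial `1`. -/
def ev (a : Fin 3 → k) : Free4 k →ₗ[k] Poly4 k :=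
  LinearMap.applyₗ (1 : Poly4 k) ∘ₗ (rep a).toLinearMap

theorem ev_apply (a : Fin 3 → k) (x : Free4 k) : ev a x = rep a x 1 := rfl

theorem ev_mul (a : Fin 3 → k) (x y : Free4 k) : ev a (x * y) = rep a x (ev a y) := by
  simp [ev_apply]

/-- The ordered word `v^b u^a v'^d u'^c` in the values of the four letters. -/
def word {B : Type*} [Ring B] (f : Gen4 → B) (m : Gen4 →₀ ℕ) : B :=
  f Gen4.v ^ m Gen4.v * f Gen4.u ^ m Gen4.u * f Gen4.v' ^ m Gen4.v' * f Gen4.u' ^ m Gen4.u'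

/-- The linear map that sends a monomial to the ordered word in the free algebra. -/
def sec : Poly4 k →ₗ[k] Free4 k :=
  (basisMonomials Gen4 k).constr k (word (FreeAlgebra.ι k))

@[simp] theorem sec_monomial (m : Gen4 →₀ ℕ) (c : k) :
    sec (monomial m c) = c • word (FreeAlgebra.ι k) m := by
  have h : monomial m c = c • basisMonomials Gen4 k m := by simp [smul_monomial]
  rw [h, map_smul, sec, Module.Basis.constr_basis]

/-! ### Normal forms -/

section Words

variable {B : Type*} [Ring B]

/-- Moving `x` past a power of `y` when the commutator `z = x y - y x` commutes with `y`. -/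
theorem mul_pow_of_commutator (k : Type*) [CommRing k] [Algebra k B] {x y z : B}
    (h : x * y = y * x + z) (hz : z * y = y * z) (n : ℕ) :
    x * y ^ n = y ^ n * x + (n : k) • (y ^ (n - 1) * z) := by
  induction n with
  | zero => simp
  | succ n ih =>
    rw [pow_succ, ← mul_assoc, ih, add_mul, mul_assoc (y ^ n), h, smul_mul_assoc, mul_assoc, hz,
      ← mul_assoc _ y z, mul_add, ← mul_assoc, ← pow_succ, Nat.add_sub_cancel]
    rcases n with _ | n
    · simp
    · rw [Nat.add_sub_cancel, ← pow_succ, Nat.cast_succ, Nat.cast_succ, Nat.cast_succ]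
      module

/-- Moving `x` past a power of `y` when they commute. -/
theorem mul_pow_of_comm {x y : B} (h : x * y = y * x) (n : ℕ) : x * y ^ n = y ^ n * x :=
  (Commute.pow_right h n)

end Words

section NormalForm

variable {B : Type*} [Ring B] [Algebra k B]

theorem X_mul_monomial_one (i : Gen4) (m : Gen4 →₀ ℕ) (c : k) :
    X i * monomial m c = monomial (m + Finsupp.single i 1) c := by
  rw [X, monomial_mul, one_mul, add_comm]

theorem X_sq_mul_pderiv_monomial (i : Gen4) (m : Gen4 →₀ ℕ) :
    X i ^ 2 * pderiv i (monomial m (1 : k)) =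
      (m i : k) • monomial (m + Finsupp.single i 1) 1 := by
  rw [pow_two, mul_assoc, X_mul_pderiv_monomial, mul_smul_comm, X_mul_monomial_one,
    Nat.cast_smul_eq_nsmul]

/-- When `m i = 0` the truncated exponent is meaningless, but the scalar in front of it is zero. -/
theorem pderiv_monomial_one (i : Gen4) (m : Gen4 →₀ ℕ) :
    pderiv i (monomial m (1 : k)) = (m i : k) • monomial (m - Finsupp.single i 1) 1 := by
  rw [pderiv_monomial, one_mul, smul_monomial, smul_eq_mul, mul_one]

theorem opGen_u_monomial (a : Fin 3 → k) (m : Gen4 →₀ ℕ) :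
    opGen a Gen4.u (monomial m 1) = monomial (m + Finsupp.single Gen4.u 1) 1 +
      (m Gen4.v : k) • monomial (m + Finsupp.single Gen4.v 1) 1 -
      a 0 • (m Gen4.v : k) • monomial (m - Finsupp.single Gen4.v 1) 1 := by
  rw [opGen_u, sub_mul, X_mul_monomial_one, X_sq_mul_pderiv_monomial, pderiv_monomial_one,
    ← MvPolynomial.smul_eq_C_mul, add_sub_assoc]

theorem opGen_u'_monomial (a : Fin 3 → k) (m : Gen4 →₀ ℕ) :
    opGen a Gen4.u' (monomial m 1) = monomial (m + Finsupp.single Gen4.u' 1) 1 -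
      ((m Gen4.v' : k) • monomial (m + Finsupp.single Gen4.v' 1) 1 +
      a 1 • (m Gen4.v' : k) • monomial (m - Finsupp.single Gen4.v' 1) 1) -
      a 2 • (m Gen4.u : k) • monomial (m - Finsupp.single Gen4.u 1) 1 := by
  rw [opGen_u', add_mul, X_mul_monomial_one, X_sq_mul_pderiv_monomial, pderiv_monomial_one,
    pderiv_monomial_one, ← MvPolynomial.smul_eq_C_mul]

theorem map_word (φ : Free4 k →ₐ[k] B) (m : Gen4 →₀ ℕ) :
    φ (word (FreeAlgebra.ι k) m) = word (fun x => φ (FreeAlgebra.ι k x)) m := by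
  simp [word]

/-- The deformed relations, solved for the products that are not ordered. -/
theorem letter_relations {a : Fin 3 → k} {φ : Free4 k →ₐ[k] B}
    (h : ∀ i, φ (rel k i) = algebraMap k B (shift a i)) (f : Gen4 → B)
    (hf : ∀ x, f x = φ (FreeAlgebra.ι k x)) :
    f Gen4.u * f Gen4.v = f Gen4.v * f Gen4.u + (f Gen4.v ^ 2 - a 0 • 1) ∧
    f Gen4.u' * f Gen4.v' = f Gen4.v' * f Gen4.u' + -(f Gen4.v' ^ 2 + a 1 • 1) ∧
    f Gen4.u' * f Gen4.u = f Gen4.u * f Gen4.u' + -(a 2 • 1) ∧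
    f Gen4.u' * f Gen4.v = f Gen4.v * f Gen4.u' ∧
    f Gen4.v' * f Gen4.u = f Gen4.u * f Gen4.v' ∧
    f Gen4.v' * f Gen4.v = f Gen4.v * f Gen4.v' := by
  have h0 := h 0
  have h1 := h 1
  have h2 := h 2
  have h3 := h 3
  have h4 := h 4
  have h5 := h 5
  simp only [rel, shift, Matrix.cons_val, map_sub, map_add, map_mul, map_pow, ← hf, map_zero,
    Algebra.algebraMap_eq_smul_one] at h0 h1 h2 h3 h4 h5
  refine ⟨?_, ?_, ?_, (sub_eq_zero.mp h3).symm, (sub_eq_zero.mp h4).symm,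
    (sub_eq_zero.mp h5).symm⟩
  · rw [← h0]; abel
  · rw [← h1]; abel
  · rw [← h2]; abel

theorem smul_pow_pred_mul_sq (y : B) (n : ℕ) :
    (n : k) • (y ^ (n - 1) * y ^ 2) = (n : k) • y ^ (n + 1) := by
  rcases n with _ | n
  · simp
  · rw [← pow_add]
    congr 2

/-- Multiplication of an ordered word by a letter on the left. -/
theorem letter_mul_word {a : Fin 3 → k} {φ : Free4 k →ₐ[k] B}
    (h : ∀ i, φ (rel k i) = algebraMap k B (shift a i)) (x : Gen4) (m : Gen4 →₀ ℕ) :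
    φ (FreeAlgebra.ι k x) * φ (sec (monomial m 1)) = φ (sec (opGen a x (monomial m 1))) := by
  obtain ⟨f, hf⟩ : ∃ f : Gen4 → B, f = fun x => φ (FreeAlgebra.ι k x) := ⟨_, rfl⟩
  obtain ⟨huv, hu'v', hu'u, hu'v, hv'u, hv'v⟩ := letter_relations h f (congrFun hf)
  have hw : ∀ m, φ (word (FreeAlgebra.ι k) m) = word f m := fun m => by rw [map_word, hf]
  rw [sec_monomial, one_smul, hw, show φ (FreeAlgebra.ι k x) = f x by rw [hf]]
  cases x with
  | v =>
    rw [opGen_v, X_mul_monomial_one, sec_monomial, one_smul, hw]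
    simp [word, pow_succ', mul_assoc]
  | v' =>
    rw [opGen_v', X_mul_monomial_one, sec_monomial, one_smul, hw]
    have h1 := mul_pow_of_comm hv'v (m Gen4.v)
    have h2 := mul_pow_of_comm hv'u (m Gen4.u)
    simp only [word, Finsupp.add_apply, Finsupp.single_apply, reduceCtorEq, if_true, if_false,
      add_zero, pow_succ', ← mul_assoc]
    rw [h1, mul_assoc _ (f Gen4.v'), h2, ← mul_assoc]
  | u =>
    rw [opGen_u_monomial]
    simp only [map_sub, map_add, map_smul, sec_monomial, one_smul, hw]
    -- The word starts with `v^b u^a`, so `u` only has to pass `v^b`; its commutator `v² - a₀` with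
    -- `v` commutes with `v`.
    have h1 := mul_pow_of_commutator k huv
      (by rw [sub_mul, mul_sub, ← pow_succ, ← pow_succ', smul_one_mul, mul_smul_one]) (m Gen4.v)
    rw [mul_sub, smul_sub, smul_pow_pred_mul_sq, mul_smul_one] at h1
    simp only [word, Finsupp.add_apply, Finsupp.tsub_apply, Finsupp.single_apply, reduceCtorEq,
      if_true, if_false, add_zero, tsub_zero, ← mul_assoc]
    rw [h1, pow_succ' (f Gen4.u)]
    simp only [add_mul, sub_mul, mul_assoc, smul_mul_assoc]
    module
  | u' =>
    rw [opGen_u'_monomial]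
    simp only [map_sub, map_add, map_smul, sec_monomial, one_smul, hw]
    -- The letter `u'` stands last in an ordered word, so it passes all three other powers: freely
    -- past `v`, with a scalar commutator past `u`, and with commutator `-(v'² + a₁)` past `v'`.
    have h1 := mul_pow_of_comm hu'v (m Gen4.v)
    have h2 := mul_pow_of_commutator k hu'u
      (by rw [neg_mul, mul_neg, smul_one_mul, mul_smul_one]) (m Gen4.u)
    have h3 := mul_pow_of_commutator k hu'v'
      (by rw [neg_mul, mul_neg, add_mul, mul_add, ← pow_succ, ← pow_succ', smul_one_mul,
        mul_smul_one]) (m Gen4.v')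
    rw [mul_neg, mul_smul_one] at h2
    rw [mul_neg, mul_add, smul_neg, smul_add, smul_pow_pred_mul_sq, mul_smul_one] at h3
    simp only [word, Finsupp.add_apply, Finsupp.tsub_apply, Finsupp.single_apply, reduceCtorEq,
      if_true, if_false, add_zero, tsub_zero, ← mul_assoc]
    rw [h1, mul_assoc _ (f Gen4.u'), h2, mul_add, add_mul, add_mul, ← mul_assoc,
      mul_assoc _ (f Gen4.u'), h3, pow_succ' (f Gen4.u')]
    simp only [add_mul, mul_add, neg_mul, mul_neg, smul_neg, mul_assoc, smul_mul_assoc,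
      mul_smul_comm]
    module

theorem letter_mul_sec {a : Fin 3 → k} {φ : Free4 k →ₐ[k] B}
    (h : ∀ i, φ (rel k i) = algebraMap k B (shift a i)) (x : Gen4) (p : Poly4 k) :
    φ (FreeAlgebra.ι k x) * φ (sec p) = φ (sec (opGen a x p)) := by
  have h' : LinearMap.mulLeft k (φ (FreeAlgebra.ι k x)) ∘ₗ φ.toLinearMap ∘ₗ sec =
      φ.toLinearMap ∘ₗ sec ∘ₗ opGen a x := by
    refine (basisMonomials Gen4 k).ext fun m => ?_
    simpa using letter_mul_word h x m
  exact LinearMap.congr_fun h' p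

/-- The map `p ↦ φ (sec p)` intertwines the polynomial representation with left multiplication in
`B`, so the image of the ordered words is stable under left multiplication by the image of `φ`. -/
theorem map_mul_sec {a : Fin 3 → k} {φ : Free4 k →ₐ[k] B}
    (h : ∀ i, φ (rel k i) = algebraMap k B (shift a i)) (x : Free4 k) (p : Poly4 k) :
    φ x * φ (sec p) = φ (sec (rep a x p)) := by
  induction x using FreeAlgebra.induction generalizing p with
  | grade0 r =>
    rw [AlgHom.commutes, AlgHom.commutes, Module.algebraMap_end_apply, map_smul, map_smul,
      Algebra.smul_def]
  | grade1 x => rw [letter_mul_sec h, rep_ι]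
  | mul x y hx hy => rw [map_mul, mul_assoc, hy, hx, map_mul, Module.End.mul_apply]
  | add x y hx hy => rw [map_add, add_mul, hx, hy, map_add, LinearMap.add_apply, map_add, map_add]

theorem sec_one : sec (1 : Poly4 k) = 1 := by
  rw [show (1 : Poly4 k) = monomial 0 1 from rfl, sec_monomial, one_smul]
  simp [word]

/-- In an algebra in which the relations hold, every element equals its normal form. -/
theorem map_sec_ev {a : Fin 3 → k} {φ : Free4 k →ₐ[k] B}
    (h : ∀ i, φ (rel k i) = algebraMap k B (shift a i)) (x : Free4 k) :
    φ (sec (ev a x)) = φ x := by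
  have := map_mul_sec h x 1
  rw [sec_one, map_one, mul_one] at this
  exact this.symm

/-- This is the half of the kernel computation that needs no independence: whatever `ev a` kills
already follows from the deformed relations. -/
theorem map_eq_zero_of_ev_eq_zero {a : Fin 3 → k} {φ : Free4 k →ₐ[k] B}
    (h : ∀ i, φ (rel k i) = algebraMap k B (shift a i)) {x : Free4 k} (hx : ev a x = 0) :
    φ x = 0 := by
  rw [← map_sec_ev h, hx, map_zero, map_zero]

/-- Scaling the letters by a square root of one respects the deformed relations. -/
theorem rep_freeScale_rel (a : Fin 3 → k) {c : k} (hc : c * c = 1) (i : Fin 6) :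
    rep a (freeScale k Gen4 c (rel k i)) = algebraMap k _ (shift a i) := by
  have : freeScale k Gen4 c (rel k i) = rel k i := by
    fin_cases i <;> simp [rel, pow_two, smul_smul, hc]
  rw [this, rep_rel]

/-- The relations are quadratic, so scaling by `c` with `c² = 1` fixes them, and the twisted
representation again satisfies the deformed relations. -/
theorem ev_freeScale_eq_zero {a : Fin 3 → k} {c : k} (hc : c * c = 1) {x : Free4 k}
    (hx : ev a x = 0) : ev a (freeScale k Gen4 c x) = 0 := by
  have := map_eq_zero_of_ev_eq_zero (φ := (rep a).comp (freeScale k Gen4 c))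
    (rep_freeScale_rel a hc) hx
  rw [ev_apply]
  exact LinearMap.congr_fun this 1

end NormalForm

/-! ### Degrees -/

instance : Fintype Gen4 := ⟨{Gen4.u, Gen4.v, Gen4.u', Gen4.v'}, fun x => by cases x <;> simp⟩

theorem sum_gen4 {M : Type*} [AddCommMonoid M] (f : Gen4 → M) :
    ∑ x, f x = f Gen4.u + f Gen4.v + f Gen4.u' + f Gen4.v' := by
  change ∑ x ∈ {Gen4.u, Gen4.v, Gen4.u', Gen4.v'}, f x = _
  simp [add_assoc]

/-- The span of the four letters. -/
def letters (k : Type*) [CommRing k] : Submodule k (Free4 k) :=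
  Submodule.span k (Set.range (FreeAlgebra.ι k))

/-- The elements of the free algebra of degree less than `n`. -/
def freeLT (k : Type*) [CommRing k] : ℕ → Submodule k (Free4 k)
  | 0 => ⊥
  | n + 1 => freeLE k n

/-- The polynomials of degree less than `n`. -/
def polyLT (k : Type*) [CommRing k] (n : ℕ) : Submodule k (Poly4 k) :=
  restrictSupport k {m | m.degree < n}

/-- The homogeneous polynomials of degree `n`. -/
def polyEQ (k : Type*) [CommRing k] (n : ℕ) : Submodule k (Poly4 k) :=
  restrictSupport k {m | m.degree = n}

theorem map_mem_of_monomial {σ M : Type*} [AddCommMonoid M] [Module k M]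
    (T : MvPolynomial σ k →ₗ[k] M) {S : Set (σ →₀ ℕ)} {N : Submodule k M}
    (h : ∀ m ∈ S, T (monomial m 1) ∈ N) {p : MvPolynomial σ k} (hp : p ∈ restrictSupport k S) :
    T p ∈ N := by
  rw [restrictSupport_eq_span] at hp
  have : Submodule.span k ((monomial · (1 : k)) '' S) ≤ N.comap T := by
    rw [Submodule.span_le]
    rintro _ ⟨m, hm, rfl⟩
    exact h m hm
  exact this hp

theorem monomial_mem_polyLT {m : Gen4 →₀ ℕ} {n : ℕ} (h : m.degree < n) :
    monomial m (1 : k) ∈ polyLT k n :=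
  (monomial_mem_restrictSupport (R := k)).2 (Or.inl h)

theorem monomial_mem_polyEQ {m : Gen4 →₀ ℕ} {n : ℕ} (h : m.degree = n) :
    monomial m (1 : k) ∈ polyEQ k n :=
  (monomial_mem_restrictSupport (R := k)).2 (Or.inl h)

theorem polyLT_mono {i j : ℕ} (h : i ≤ j) : polyLT k i ≤ polyLT k j :=
  restrictSupport_mono _ fun _ hm => lt_of_lt_of_le hm h

theorem polyEQ_le_polyLT {i j : ℕ} (h : i < j) : polyEQ k i ≤ polyLT k j :=
  restrictSupport_mono _ fun m (hm : m.degree = i) => show m.degree < j from hm ▸ h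

theorem eq_zero_of_mem_polyEQ_of_mem_polyLT {n : ℕ} {p : Poly4 k} (h : p ∈ polyEQ k n)
    (h' : p ∈ polyLT k n) : p = 0 := by
  by_contra hp
  obtain ⟨m, hm⟩ := Finset.nonempty_iff_ne_empty.mpr (mt support_eq_empty.mp hp)
  have h1 : m.degree = n := (mem_restrictSupport_iff (r := p)).1 h hm
  have h2 : m.degree < n := (mem_restrictSupport_iff (r := p)).1 h' hm
  omega

theorem natCast_smul_monomial_mem_polyLT (m : Gen4 →₀ ℕ) (i : Gen4) :
    (m i : k) • monomial (m - Finsupp.single i 1) (1 : k) ∈ polyLT k m.degree := by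
  rcases Nat.eq_zero_or_pos (m i) with h | h
  · simp [h]
  · refine Submodule.smul_mem _ _ (monomial_mem_polyLT ?_)
    have h1 : m - Finsupp.single i 1 + Finsupp.single i 1 = m := by
      refine tsub_add_cancel_of_le ?_
      rw [Finsupp.single_le_iff]
      exact h
    have h2 := congrArg Finsupp.degree h1
    simp only [map_add, Finsupp.degree_single] at h2
    omega

theorem opGen_zero_monomial_mem (x : Gen4) (m : Gen4 →₀ ℕ) :
    opGen (0 : Fin 3 → k) x (monomial m 1) ∈ polyEQ k (m.degree + 1) := by
  have h : ∀ i, monomial (m + Finsupp.single i 1) (1 : k) ∈ polyEQ k (m.degree + 1) :=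
    fun i => monomial_mem_polyEQ (by simp)
  cases x with
  | u =>
    rw [opGen_u_monomial, Pi.zero_apply, zero_smul, sub_zero]
    exact add_mem (h _) (Submodule.smul_mem _ _ (h _))
  | v =>
    rw [opGen_v, X_mul_monomial_one]
    exact h _
  | u' =>
    rw [opGen_u'_monomial, Pi.zero_apply, Pi.zero_apply, zero_smul, zero_smul, sub_zero, add_zero]
    exact sub_mem (h _) (Submodule.smul_mem _ _ (h _))
  | v' =>
    rw [opGen_v', X_mul_monomial_one]
    exact h _

/-- The parameters `a` enter only through multiples of partial derivatives, which lower the degree.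
-/
theorem opGen_sub_opGen_zero_monomial_mem (a : Fin 3 → k) (x : Gen4) (m : Gen4 →₀ ℕ) :
    (opGen a x - opGen 0 x : Module.End k (Poly4 k)) (monomial m 1) ∈ polyLT k m.degree := by
  have h := natCast_smul_monomial_mem_polyLT (k := k) m
  rw [LinearMap.sub_apply]
  cases x with
  | u =>
    rw [opGen_u_monomial, opGen_u_monomial, Pi.zero_apply, zero_smul, sub_zero, sub_sub_cancel_left]
    exact neg_mem (Submodule.smul_mem _ _ (h _))
  | v =>
    rw [opGen_v, opGen_v, sub_self]
    exact zero_mem _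
  | u' =>
    rw [opGen_u'_monomial, opGen_u'_monomial, Pi.zero_apply, Pi.zero_apply, zero_smul, zero_smul,
      sub_zero, add_zero]
    convert neg_mem (add_mem (Submodule.smul_mem _ (a 1) (h Gen4.v'))
      (Submodule.smul_mem _ (a 2) (h Gen4.u))) using 1
    abel
  | v' =>
    rw [opGen_v', opGen_v', sub_self]
    exact zero_mem _

theorem opGen_zero_mem_polyEQ (x : Gen4) {n : ℕ} {p : Poly4 k} (hp : p ∈ polyEQ k n) :
    opGen 0 x p ∈ polyEQ k (n + 1) :=
  map_mem_of_monomial _ (fun m (hm : m.degree = n) => hm ▸ opGen_zero_monomial_mem x m) hp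

theorem opGen_mem_polyLT (a : Fin 3 → k) (x : Gen4) {n : ℕ} {p : Poly4 k} (hp : p ∈ polyLT k n) :
    opGen a x p ∈ polyLT k (n + 1) := by
  refine map_mem_of_monomial (S := {m | m.degree < n}) _ (fun m (hm : m.degree < n) => ?_) hp
  have h1 := polyEQ_le_polyLT (Nat.succ_lt_succ hm) (opGen_zero_monomial_mem (k := k) x m)
  have h2 := polyLT_mono (by omega : m.degree ≤ n + 1) (opGen_sub_opGen_zero_monomial_mem a x m)
  simpa using add_mem h1 h2

theorem opGen_sub_opGen_zero_mem (a : Fin 3 → k) (x : Gen4) {n : ℕ} {p : Poly4 k}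
    (hp : p ∈ polyLT k (n + 1)) : (opGen a x - opGen 0 x : Module.End k (Poly4 k)) p ∈ polyLT k n :=
  map_mem_of_monomial _ (fun m (hm : m.degree < n + 1) =>
    polyLT_mono (by omega) (opGen_sub_opGen_zero_monomial_mem a x m)) hp

theorem one_mem_polyEQ : (1 : Poly4 k) ∈ polyEQ k 0 := monomial_mem_polyEQ (map_zero _)

/-- To prove a closure property of `letters ^ n`, multiply by letters on the left. -/
theorem letters_pow_induction {Q : ℕ → Submodule k (Free4 k)} (h0 : 1 ∈ Q 0)
    (h : ∀ n x y, y ∈ Q n → FreeAlgebra.ι k x * y ∈ Q (n + 1)) (n : ℕ) : letters k ^ n ≤ Q n := by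
  induction n with
  | zero =>
    rw [pow_zero, Submodule.one_le]
    exact h0
  | succ n ih =>
    rw [pow_succ', Submodule.mul_le]
    intro w hw y hy
    have hw' : letters k ≤ (Q (n + 1)).comap (LinearMap.mulRight k y) := by
      unfold letters
      rw [Submodule.span_le]
      rintro _ ⟨x, rfl⟩
      exact h n x y (ih hy)
    exact hw' hw

theorem ev_ι_mul (a : Fin 3 → k) (x : Gen4) (y : Free4 k) :
    ev a (FreeAlgebra.ι k x * y) = opGen a x (ev a y) := by
  rw [ev_mul, rep_ι]

@[simp] theorem ev_one (a : Fin 3 → k) : ev a (1 : Free4 k) = 1 := by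
  simp [ev_apply]

theorem ev_zero_mem_polyEQ {n : ℕ} {x : Free4 k} (hx : x ∈ letters k ^ n) :
    ev 0 x ∈ polyEQ k n := by
  refine letters_pow_induction (Q := fun n => (polyEQ k n).comap (ev 0)) ?_ ?_ n hx
  · rw [Submodule.mem_comap, ev_one]
    exact one_mem_polyEQ
  · intro n x y hy
    rw [Submodule.mem_comap, ev_ι_mul]
    exact opGen_zero_mem_polyEQ x hy

theorem ev_sub_ev_zero_mem_polyLT (a : Fin 3 → k) {n : ℕ} {x : Free4 k} (hx : x ∈ letters k ^ n) :
    ev a x - ev 0 x ∈ polyLT k n := by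
  -- The induction also carries the degree bound on `ev a`, since the new difference is `opGen 0 x
  -- (ev a y - ev 0 y) + (opGen a x - opGen 0 x) (ev a y)`.
  refine (letters_pow_induction (Q := fun n => (polyLT k n).comap (ev a - ev 0) ⊓
    (polyLT k (n + 1)).comap (ev a)) ?_ ?_ n hx).1
  · constructor
    · rw [SetLike.mem_coe, Submodule.mem_comap, LinearMap.sub_apply, ev_one, ev_one, sub_self]
      exact zero_mem _
    · rw [SetLike.mem_coe, Submodule.mem_comap, ev_one]
      exact polyEQ_le_polyLT (Nat.lt_succ_self 0) one_mem_polyEQ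
  · rintro n x y ⟨h1, h2⟩
    constructor
    · have h3 := opGen_mem_polyLT 0 x h1
      have h4 := polyLT_mono n.le_succ (opGen_sub_opGen_zero_mem a x h2)
      rw [SetLike.mem_coe, Submodule.mem_comap, LinearMap.sub_apply, ev_ι_mul, ev_ι_mul]
      convert add_mem h3 h4 using 1
      simp
    · rw [SetLike.mem_coe, Submodule.mem_comap, ev_ι_mul]
      exact opGen_mem_polyLT a x h2

theorem letters_pow_le_freeLE {i n : ℕ} (h : i ≤ n) : letters k ^ i ≤ freeLE k n :=
  (pow_le_pow_left' le_sup_right i).trans (freeLE_mono k h)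

/-- This splits off a leading part made of words of length exactly `n`. -/
theorem freeLE_le (n : ℕ) : freeLE k n ≤ letters k ^ n ⊔ freeLT k n := by
  induction n with
  | zero => simp [freeLE]
  | succ n ih =>
    have h : freeLE k (n + 1) = freeLE k n ⊔ letters k * freeLE k n := by
      rw [freeLE, pow_succ', Submodule.sup_mul, one_mul]
      rfl
    have h' : letters k * freeLT k n ≤ freeLE k n := by
      cases n with
      | zero => simp [freeLT]
      | succ n =>
        rw [freeLT, Submodule.mul_le]
        intro x hx y hy
        rw [add_comm]
        exact freeLE_mul (letters_pow_le_freeLE le_rfl (by rwa [pow_one])) hy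
    rw [h]
    refine sup_le le_sup_right ((mul_le_mul' le_rfl ih).trans ?_)
    rw [Submodule.mul_sup, ← pow_succ']
    exact sup_le_sup_left h' _

theorem ev_mem_polyLT (a : Fin 3 → k) {n : ℕ} {x : Free4 k} (hx : x ∈ freeLT k n) :
    ev a x ∈ polyLT k n := by
  induction n generalizing x with
  | zero =>
    rw [(Submodule.mem_bot k).mp hx, map_zero]
    exact zero_mem _
  | succ n ih =>
    obtain ⟨y, hy, z, hz, rfl⟩ := Submodule.mem_sup.mp (freeLE_le n hx)
    rw [map_add]
    refine add_mem ?_ (polyLT_mono n.le_succ (ih hz))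
    have := add_mem (polyEQ_le_polyLT n.lt_succ_self (ev_zero_mem_polyEQ hy))
      (polyLT_mono n.le_succ (ev_sub_ev_zero_mem_polyLT a hy))
    rwa [add_sub_cancel] at this

theorem word_mem_letters_pow (m : Gen4 →₀ ℕ) :
    word (FreeAlgebra.ι k) m ∈ letters k ^ m.degree := by
  have h : ∀ (x : Gen4) (n : ℕ), FreeAlgebra.ι k x ^ n ∈ letters k ^ n := fun x n =>
    Submodule.pow_mem_pow _ (show _ ∈ letters k from Submodule.subset_span ⟨x, rfl⟩) n
  have hm : m.degree = m Gen4.v + m Gen4.u + m Gen4.v' + m Gen4.u' := by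
    rw [Finsupp.degree_eq_sum, sum_gen4]
    omega
  rw [hm, pow_add, pow_add, pow_add]
  exact Submodule.mul_mem_mul (Submodule.mul_mem_mul (Submodule.mul_mem_mul (h _ _) (h _ _))
    (h _ _)) (h _ _)

theorem sec_mem_freeLT {n : ℕ} {p : Poly4 k} (hp : p ∈ polyLT k n) : sec p ∈ freeLT k n := by
  refine map_mem_of_monomial _ (fun m (hm : m.degree < n) => ?_) hp
  obtain ⟨n, rfl⟩ := Nat.exists_eq_succ_of_ne_zero (Nat.ne_zero_of_lt hm)
  rw [sec_monomial, one_smul]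
  exact letters_pow_le_freeLE (Nat.lt_succ_iff.mp hm) (word_mem_letters_pow m)

/-! ### The presentation of `A ⊗ Aᵒᵖ` -/

/-- The homomorphism from the free algebra onto `A ⊗ Aᵒᵖ`. -/
def envHom (k : Type*) [CommRing k] : Free4 k →ₐ[k] Env k := FreeAlgebra.lift k (envGen k)

@[simp] theorem envHom_ι (x : Gen4) : envHom k (FreeAlgebra.ι k x) = envGen k x :=
  FreeAlgebra.lift_ι_apply _ _

theorem envHom_rel (i : Fin 6) : envHom k (rel k i) = 0 := by
  have h := jgen_rel k
  fin_cases i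
  · have h' := congrArg (fun z => z ⊗ₜ[k] (1 : (JordanPlane k)ᵐᵒᵖ)) h
    simpa [rel, envGen, TensorProduct.add_tmul, TensorProduct.sub_tmul, pow_two] using h'
  -- Passing to the opposite algebra reverses products and turns the Jordan relation into `-r₂`,
  -- hence the sign.
  · have h' := congrArg (fun z => -((1 : JordanPlane k) ⊗ₜ[k] MulOpposite.op z)) h
    simp only [MulOpposite.op_add, MulOpposite.op_sub, MulOpposite.op_mul,
      TensorProduct.tmul_add, TensorProduct.tmul_sub, MulOpposite.op_zero, TensorProduct.tmul_zero,
      neg_zero, pow_two] at h'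
    simp only [rel, envGen, Matrix.cons_val, Fin.mk_one, map_sub, map_mul, envHom_ι, pow_two,
      Algebra.TensorProduct.tmul_mul_tmul, one_mul]
    rw [← h']
    abel
  all_goals simp [rel, envGen]

/-- The relations of `k⟨u, v, u', v'⟩ / (r₁, …, r₆)`. -/
theorem presMk_rel (i : Fin 6) : presMk k (rel k i) = 0 := by
  have h : presMk k _ = presMk k _ :=
    RingQuot.mkAlgHom_rel k (show PresRel k (rel k i) 0 from ⟨⟨i, rfl⟩, rfl⟩)
  rw [h, map_zero]

/-- The homomorphism from the presented algebra to `A ⊗ Aᵒᵖ`. -/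
def presToEnv (k : Type*) [CommRing k] : Presented k →ₐ[k] Env k :=
  RingQuot.liftAlgHom k ⟨envHom k, by rintro _ _ ⟨⟨i, rfl⟩, rfl⟩; rw [envHom_rel, map_zero]⟩

theorem presToEnv_presMk (x : Free4 k) : presToEnv k (presMk k x) = envHom k x :=
  RingQuot.liftAlgHom_mkAlgHom_apply k (envHom k) _ x

theorem presToEnv_presGen (x : Gen4) : presToEnv k (presGen k x) = envGen k x := by
  rw [presGen, presToEnv_presMk, envHom_ι]

/-- The commutation relations between the letters of the presented algebra. -/
theorem presGen_relations :
    presGen k Gen4.v * presGen k Gen4.u - presGen k Gen4.u * presGen k Gen4.v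
      + presGen k Gen4.v ^ 2 = 0 ∧
    presGen k Gen4.v' * presGen k Gen4.u' - presGen k Gen4.u' * presGen k Gen4.v'
      - presGen k Gen4.v' ^ 2 = 0 ∧
    Commute (presGen k Gen4.u) (presGen k Gen4.u') ∧
    Commute (presGen k Gen4.v) (presGen k Gen4.u') ∧
    Commute (presGen k Gen4.u) (presGen k Gen4.v') ∧
    Commute (presGen k Gen4.v) (presGen k Gen4.v') := by
  have h : ∀ i, presMk k (rel k i) = 0 := presMk_rel
  have h0 := h 0
  have h1 := h 1
  have h2 := h 2
  have h3 := h 3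
  have h4 := h 4
  have h5 := h 5
  simp only [rel, Matrix.cons_val, map_sub, map_add, map_mul, map_pow] at h0 h1 h2 h3 h4 h5
  exact ⟨h0, h1, sub_eq_zero.mp h2, sub_eq_zero.mp h3, sub_eq_zero.mp h4, sub_eq_zero.mp h5⟩

/-- The embedding of the left factor `A` into the presented algebra. -/
def presLeft (k : Type*) [CommRing k] : JordanPlane k →ₐ[k] Presented k :=
  jlift k (FreeAlgebra.lift k fun
    | Gen2.u => presGen k Gen4.u
    | Gen2.v => presGen k Gen4.v) (by simpa using presGen_relations.1)

/-- The embedding of the right factor `Aᵒᵖ` into the presented algebra, as a homomorphism from `A`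
to the opposite algebra. -/
def presRightOp (k : Type*) [CommRing k] : JordanPlane k →ₐ[k] (Presented k)ᵐᵒᵖ :=
  jlift k (FreeAlgebra.lift k fun
    | Gen2.u => MulOpposite.op (presGen k Gen4.u')
    | Gen2.v => MulOpposite.op (presGen k Gen4.v')) (by
      have h := congrArg (fun z => -MulOpposite.op z) (presGen_relations (k := k)).2.1
      simp only [MulOpposite.op_sub, MulOpposite.op_mul, MulOpposite.op_pow, MulOpposite.op_zero,
        neg_zero] at h
      simp only [map_add, map_sub, map_mul, map_pow, FreeAlgebra.lift_ι_apply]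
      rw [← h]
      abel)

theorem presLeft_jgen (x : Gen2) : presLeft k (jgen k x) =
    presGen k (match x with | Gen2.u => Gen4.u | Gen2.v => Gen4.v) := by
  rw [presLeft, jgen, jlift_jmk, FreeAlgebra.lift_ι_apply]
  cases x <;> rfl

theorem presRightOp_jgen (x : Gen2) : presRightOp k (jgen k x) =
    MulOpposite.op (presGen k (match x with | Gen2.u => Gen4.u' | Gen2.v => Gen4.v')) := by
  rw [presRightOp, jgen, jlift_jmk, FreeAlgebra.lift_ι_apply]
  cases x <;> rfl

/-- The embedding of the right factor `Aᵒᵖ` into the presented algebra. -/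
def presRight (k : Type*) [CommRing k] : (JordanPlane k)ᵐᵒᵖ →ₐ[k] Presented k :=
  AlgHom.opComm (presRightOp k)

theorem presRight_op (x : JordanPlane k) :
    presRight k (MulOpposite.op x) = (presRightOp k x).unop := rfl

theorem jordan_induction {S : Subalgebra k (JordanPlane k)} (h : ∀ x, jgen k x ∈ S)
    (x : JordanPlane k) : x ∈ S := by
  obtain ⟨y, rfl⟩ := RingQuot.mkAlgHom_surjective k (JordanRel k) x
  change jmk k y ∈ S
  induction y using FreeAlgebra.induction with
  | grade0 r =>
    rw [AlgHom.commutes]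
    exact S.algebraMap_mem r
  | grade1 x => exact h x
  | mul a b ha hb =>
    rw [map_mul]
    exact mul_mem ha hb
  | add a b ha hb =>
    rw [map_add]
    exact add_mem ha hb

/-- Centralizers are subalgebras, so it is enough to check generators: the right argument is
extended to all of `A` first, then the left one. -/
theorem presLeft_commute_presRight (x : JordanPlane k) (y : (JordanPlane k)ᵐᵒᵖ) :
    Commute (presLeft k x) (presRight k y) := by
  obtain ⟨-, -, h3, h4, h5, h6⟩ := presGen_relations (k := k)
  have hx : ∀ (x : Gen2) (y : JordanPlane k),
      y ∈ (Subalgebra.centralizer k {MulOpposite.op (presLeft k (jgen k x))}).comap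
        (presRightOp k) := fun x => jordan_induction fun y => by
    rw [Subalgebra.mem_comap, Subalgebra.mem_centralizer_iff]
    rintro _ rfl
    rw [presLeft_jgen, presRightOp_jgen, ← MulOpposite.op_mul, ← MulOpposite.op_mul]
    refine congrArg MulOpposite.op ?_
    cases x <;> cases y
    exacts [h3.symm.eq, h5.symm.eq, h4.symm.eq, h6.symm.eq]
  have hy : x ∈ (Subalgebra.centralizer k {presRight k y}).comap (presLeft k) := by
    refine jordan_induction (fun x => ?_) x
    rw [Subalgebra.mem_comap, Subalgebra.mem_centralizer_iff]
    rintro _ rfl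
    have h := hx x y.unop
    rw [Subalgebra.mem_comap, Subalgebra.mem_centralizer_iff] at h
    exact congrArg MulOpposite.unop (h _ rfl)
  rw [Subalgebra.mem_comap, Subalgebra.mem_centralizer_iff] at hy
  exact (hy _ rfl).symm

/-- The homomorphism from `A ⊗ Aᵒᵖ` to the presented algebra. -/
def envToPres (k : Type*) [CommRing k] : Env k →ₐ[k] Presented k :=
  Algebra.TensorProduct.lift (presLeft k) (presRight k) presLeft_commute_presRight

theorem envToPres_envGen (x : Gen4) : envToPres k (envGen k x) = presGen k x := by
  cases x <;>
  simp [envToPres, envGen, presLeft_jgen, presRight_op, presRightOp_jgen]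

theorem presented_hom_ext {B : Type*} [Ring B] [Algebra k B] {f g : Presented k →ₐ[k] B}
    (h : ∀ x, f (presGen k x) = g (presGen k x)) : f = g := by
  apply RingQuot.ringQuot_ext'
  apply FreeAlgebra.hom_ext
  funext x
  exact h x

theorem envHom_surjective : Function.Surjective (envHom k) := by
  have hmem : ∀ x, envGen k x ∈ (envHom k).range := fun x => ⟨_, envHom_ι x⟩
  have hl : ∀ x : JordanPlane k,
      x ∈ (envHom k).range.comap (Algebra.TensorProduct.includeLeft (R := k) (S := k)) :=
    jordan_induction fun x => by
      cases x
      exacts [hmem Gen4.u, hmem Gen4.v]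
  have hr : ∀ x : JordanPlane k, x ∈ (Subalgebra.comap
      (Algebra.TensorProduct.includeRight (R := k) (A := JordanPlane k)) (envHom k).range).unop :=
    jordan_induction fun x => by
      cases x
      exacts [hmem Gen4.u', hmem Gen4.v']
  intro z
  change z ∈ (envHom k).range
  induction z using TensorProduct.induction_on with
  | zero => exact zero_mem _
  | tmul x y =>
    rw [← mul_one x, ← one_mul y, ← Algebra.TensorProduct.tmul_mul_tmul]
    exact mul_mem (hl x) (hr y.unop)
  | add x y hx hy => exact add_mem hx hy

/-- `A ⊗ Aᵒᵖ` is presented by the six relations. -/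
def presEquivEnv (k : Type*) [CommRing k] : Presented k ≃ₐ[k] Env k :=
  AlgEquiv.ofAlgHom (presToEnv k) (envToPres k)
    (by
      refine AlgHom.ext fun z => ?_
      obtain ⟨y, rfl⟩ := envHom_surjective z
      have : ((presToEnv k).comp (envToPres k)).comp (envHom k) =
          (AlgHom.id k (Env k)).comp (envHom k) := by
        apply FreeAlgebra.hom_ext
        funext x
        simp [envToPres_envGen, presToEnv_presGen]
      exact DFunLike.congr_fun this y)
    (presented_hom_ext fun x => by simp [envToPres_envGen, presToEnv_presGen])

theorem presEquivEnv_presGen (x : Gen4) : presEquivEnv k (presGen k x) = envGen k x :=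
  presToEnv_presGen x

theorem shift_zero (i : Fin 6) : shift (0 : Fin 3 → k) i = 0 := by
  fin_cases i <;> rfl

/-- The polynomials `ev 0 x` detect the vanishing of the image of `x` in `A ⊗ Aᵒᵖ`. -/
theorem envHom_eq_zero_iff {x : Free4 k} : envHom k x = 0 ↔ ev 0 x = 0 := by
  constructor
  · intro h
    have h1 : presMk k x = 0 := by
      apply (presEquivEnv k).injective
      rw [map_zero]
      exact (presToEnv_presMk x).trans h
    -- The undeformed representation kills all six relations, so it factors through the presented
    -- algebra.
    have hrel : ∀ ⦃x y⦄, PresRel k x y → rep (0 : Fin 3 → k) x = rep 0 y := by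
      rintro _ _ ⟨⟨i, rfl⟩, rfl⟩
      rw [rep_rel, shift_zero, map_zero, map_zero]
    have h2 : RingQuot.liftAlgHom k ⟨rep (0 : Fin 3 → k), hrel⟩ (presMk k x) = rep 0 x :=
      RingQuot.liftAlgHom_mkAlgHom_apply k _ _ x
    have h3 : rep 0 x = 0 := h2.symm.trans ((congrArg _ h1).trans (map_zero _))
    rw [ev_apply, h3, LinearMap.zero_apply]
  · exact map_eq_zero_of_ev_eq_zero fun i => by rw [envHom_rel, shift_zero, map_zero]

theorem envDeg_eq (n : ℕ) : envDeg k n = (letters k ^ n).map (envHom k).toLinearMap := by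
  rw [Submodule.map_pow, letters, Submodule.map_span, envDeg, ← Set.range_comp]
  congr 3
  funext x
  exact (envHom_ι x).symm

open SkewMonoidAlgebra

/-! ### Smash products -/

theorem sgn_mul_self (g : C2) : sgn k g * sgn k g = 1 := by
  change (if g = 1 then (1 : k) else -1) * (if g = 1 then 1 else -1) = 1
  split_ifs <;> simp

section Generic

variable {B : Type*} [Ring B] [Algebra k B]

/-- The element `∑ b g # g` of the smash product. -/
def smashOf (b : C2 → B) : Smash B := ⟨Finsupp.equivFunOnFinite.symm b⟩

@[simp] theorem coeff_smashOf (b : C2 → B) (g : C2) : (smashOf b).coeff g = b g := rfl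

theorem smashSub_mono {S T : Submodule k B} (h : S ≤ T) :
    (smashSub S : Submodule k (Smash B)) ≤ smashSub T := fun _ hx g => h (hx g)

@[simp] theorem smashSub_bot : (smashSub (⊥ : Submodule k B) : Submodule k (Smash B)) = ⊥ := by
  refine eq_bot_iff.mpr fun x hx => ?_
  rw [Submodule.mem_bot]
  exact SkewMonoidAlgebra.ext fun g => by simpa using hx g

theorem smashSub_sup (S T : Submodule k B) :
    (smashSub (S ⊔ T) : Submodule k (Smash B)) ≤ smashSub S ⊔ smashSub T := by
  intro x hx
  choose s hs t ht h using fun g => Submodule.mem_sup.mp (hx g)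
  exact Submodule.mem_sup.mpr ⟨smashOf s, hs, smashOf t, ht, SkewMonoidAlgebra.ext fun g => by simpa using h g⟩

variable [MulSemiringAction C2 B] [SMulCommClass C2 k B]

/-- The embedding `b ↦ b # 1` as an algebra homomorphism. -/
def smashIncl (k : Type*) [CommRing k] (B : Type*) [Ring B] [Algebra k B]
    [MulSemiringAction C2 B] [SMulCommClass C2 k B] : B →ₐ[k] Smash B where
  __ := (SkewMonoidAlgebra.singleOneRingHom : B →+* Smash B)
  commutes' _ := rfl

@[simp] theorem smashIncl_apply (b : B) : smashIncl k B b = single 1 b := rfl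

end Generic

theorem smul_algebraMap_free (g : C2) (r : k) :
    g • algebraMap k (Free4 k) r = algebraMap k (Free4 k) r := by
  rw [smul_free_def, AlgHom.commutes]

theorem smul_mem_letters_pow (g : C2) {n : ℕ} {x : Free4 k} (hx : x ∈ letters k ^ n) :
    g • x ∈ letters k ^ n := by
  refine letters_pow_induction
    (Q := fun n => (letters k ^ n).comap (freeScale k Gen4 (sgn k g)).toLinearMap) ?_ ?_ n hx
  · rw [Submodule.mem_comap, AlgHom.toLinearMap_apply, map_one, pow_zero]
    exact Submodule.one_le.mp le_rfl
  · intro n x y hy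
    rw [Submodule.mem_comap, AlgHom.toLinearMap_apply, map_mul, freeScale_ι, pow_succ']
    exact Submodule.mul_mem_mul (Submodule.smul_mem _ _ (Submodule.subset_span ⟨x, rfl⟩)) hy

theorem mul_mem_smashSub_letters_pow {i j : ℕ} {x y : Smash (Free4 k)}
    (hx : x ∈ smashSub (letters k ^ i)) (hy : y ∈ smashSub (letters k ^ j)) :
    x * y ∈ smashSub (letters k ^ (i + j)) := by
  intro g
  rw [SkewMonoidAlgebra.coeff_mul]
  refine Submodule.sum_mem _ fun a _ => Submodule.sum_mem _ fun b _ => ?_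
  dsimp only
  split_ifs
  · rw [pow_add]
    exact Submodule.mul_mem_mul (hx a) (smul_mem_letters_pow a (hy b))
  · exact Submodule.zero_mem _

theorem one_mem_smashSub_letters_pow : (1 : Smash (Free4 k)) ∈ smashSub (letters k ^ 0) := by
  intro g
  rw [SkewMonoidAlgebra.coeff_one, Finsupp.single_apply, pow_zero]
  split_ifs
  · exact Submodule.one_le.mp le_rfl
  · exact zero_mem _

/-- The homomorphism from `k⟨u, v, u', v'⟩ # kC₂` to `(A ⊗ Aᵒᵖ) # kC₂`. -/
def smashEnvHom (k : Type*) [CommRing k] : Smash (Free4 k) →ₐ[k] Smash (Env k) :=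
  liftNCAlgHom ((smashIncl k (Env k)).comp (envHom k)) (SkewMonoidAlgebra.of (Env k) C2) (by
    intro x g
    have h : ∀ y, envHom k (g • y) = g • envHom k y := fun y => by
      change (envHom k).comp (freeScale k Gen4 (sgn k g)) y =
        (envScale k (sgn k g)).comp (envHom k) y
      congr 1
      apply FreeAlgebra.hom_ext
      funext z
      cases z <;> simp [envScale, envGen, TensorProduct.smul_tmul']
    simp [SkewMonoidAlgebra.of_apply, SkewMonoidAlgebra.single_mul_single, h])

theorem smashEnvHom_single (g : C2) (b : Free4 k) :
    smashEnvHom k (single g b) = single g (envHom k b) := by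
  change liftNC _ _ (single g b) = _
  rw [liftNC_single]
  simp [SkewMonoidAlgebra.of_apply, SkewMonoidAlgebra.single_mul_single]

theorem coeff_smashEnvHom (x : Smash (Free4 k)) (g : C2) :
    (smashEnvHom k x).coeff g = envHom k (x.coeff g) := by
  induction x using SkewMonoidAlgebra.induction_on with
  | zero => simp
  | single h b =>
    classical
    rw [smashEnvHom_single, SkewMonoidAlgebra.coeff_single_apply,
      SkewMonoidAlgebra.coeff_single_apply]
    split_ifs <;> simp
  | add x y hx hy => simp [hx, hy]

theorem smashDeg_eq (n : ℕ) :
    smashDeg k n = (smashSub (letters k ^ n)).map (smashEnvHom k).toLinearMap := by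
  ext x
  constructor
  · intro hx
    have h : ∀ g, ∃ y ∈ letters k ^ n, envHom k y = x.coeff g := fun g => by
      have := hx g
      rwa [envDeg_eq] at this
    choose y hy hxy using h
    exact ⟨smashOf y, hy, SkewMonoidAlgebra.ext fun g => (coeff_smashEnvHom _ g).trans (hxy g)⟩
  · rintro ⟨y, hy, rfl⟩ g
    rw [AlgHom.toLinearMap_apply, coeff_smashEnvHom, envDeg_eq]
    exact ⟨_, hy g, rfl⟩

theorem smashEnvHom_surjective : Function.Surjective (smashEnvHom k) := fun x => by
  choose y hy using fun g => envHom_surjective (x.coeff g)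
  exact ⟨smashOf y, SkewMonoidAlgebra.ext fun g => (coeff_smashEnvHom _ g).trans (hy g)⟩

theorem smashEnvHom_eq_zero_iff {x : Smash (Free4 k)} :
    smashEnvHom k x = 0 ↔ ∀ g, ev 0 (x.coeff g) = 0 := by
  rw [SkewMonoidAlgebra.ext_iff]
  simp [coeff_smashEnvHom, envHom_eq_zero_iff]

/-! ### The kernel of the projection to `D_κ` -/

/-- This gives the uniqueness of `κ`; only spanning by the `rᵢ` is needed, not their independence.
-/
theorem relSpace_hom_ext {M : Type*} [AddCommGroup M] [Module k M] {f g : relSpace k →ₗ[k] M}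
    (h : ∀ i, f (relI k i) = g (relI k i)) : f = g := by
  refine LinearMap.ext fun ⟨x, hx⟩ => ?_
  induction hx using Submodule.span_induction with
  | mem x hx =>
    obtain ⟨i, rfl⟩ := hx
    exact h i
  | zero => exact (map_zero f).trans (map_zero g).symm
  | add x y hx hy h1 h2 =>
    exact (map_add f ⟨x, hx⟩ ⟨y, hy⟩).trans
      ((congrArg₂ _ h1 h2).trans (map_add g ⟨x, hx⟩ ⟨y, hy⟩).symm)
  | smul c x hx h1 =>
    exact (map_smul f c ⟨x, hx⟩).trans ((congrArg _ h1).trans (map_smul g c ⟨x, hx⟩).symm)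

/-- The representation `rep a`, induced to functions on `C₂`. -/
def indRep (a : Fin 3 → k) : Free4 k →ₐ[k] Module.End k (C2 → Poly4 k) :=
  FreeAlgebra.lift k fun x =>
    LinearMap.pi fun g => rep a (g⁻¹ • FreeAlgebra.ι k x) ∘ₗ LinearMap.proj g

/-- The fibre over `g` carries the representation twisted by `g⁻¹`, which makes the action
compatible with translations. -/
theorem indRep_apply (a : Fin 3 → k) (x : Free4 k) (φ : C2 → Poly4 k) (g : C2) :
    indRep a x φ g = rep a (g⁻¹ • x) (φ g) := by
  induction x using FreeAlgebra.induction generalizing φ with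
  | grade0 r =>
    rw [smul_algebraMap_free, AlgHom.commutes, AlgHom.commutes]
    rfl
  | grade1 x =>
    rw [indRep, FreeAlgebra.lift_ι_apply]
    rfl
  | mul x y hx hy =>
    rw [map_mul, Module.End.mul_apply, hx, hy, smul_mul', map_mul, Module.End.mul_apply]
  | add x y hx hy =>
    rw [map_add, LinearMap.add_apply, Pi.add_apply, hx, hy, smul_add, map_add,
      LinearMap.add_apply]

/-- The translations of functions on `C₂`. -/
def translation (k : Type*) [CommRing k] : C2 →* Module.End k (C2 → Poly4 k) where
  toFun h := LinearMap.funLeft k (Poly4 k) (h⁻¹ * ·)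
  map_one' := by
    refine LinearMap.ext fun φ => funext fun g => ?_
    simp [LinearMap.funLeft_apply]
  map_mul' h h' := by
    refine LinearMap.ext fun φ => funext fun g => ?_
    simp [LinearMap.funLeft_apply, mul_assoc, mul_comm]

theorem translation_apply (h : C2) (φ : C2 → Poly4 k) (g : C2) :
    translation k h φ g = φ (h⁻¹ * g) := rfl

/-- The representation of `k⟨u, v, u', v'⟩ # kC₂` induced from `rep a`. -/
def smashRep (a : Fin 3 → k) : Smash (Free4 k) →ₐ[k] Module.End k (C2 → Poly4 k) :=
  liftNCAlgHom (indRep a) (translation k) (by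
    intro x h
    refine LinearMap.ext fun φ => funext fun g => ?_
    rw [Module.End.mul_apply, Module.End.mul_apply, indRep_apply, translation_apply,
      translation_apply, indRep_apply, smul_smul, mul_inv_rev, inv_inv])

theorem smashRep_single (a : Fin 3 → k) (h : C2) (b : Free4 k) :
    smashRep a (single h b) = indRep a b * translation k h := by
  change liftNC _ _ (single h b) = _
  rw [liftNC_single]
  rfl

/-- Translations move the delta function at `1` to distinct points, so applying `x` to it reads off
each coefficient of `x` separately. -/
theorem smashRep_delta (a : Fin 3 → k) (x : Smash (Free4 k)) (g : C2) :
    smashRep a x (Pi.single 1 1) g = ev a (g⁻¹ • x.coeff g) := by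
  induction x using SkewMonoidAlgebra.induction_on with
  | zero => simp
  | single h b =>
    rw [smashRep_single, Module.End.mul_apply, indRep_apply, translation_apply,
      SkewMonoidAlgebra.coeff_single_apply, Pi.single_apply]
    simp only [inv_mul_eq_one]
    split_ifs
    · rfl
    · simp
  | add x y hx hy => simp [hx, hy]

theorem rep_smul_rel (a : Fin 3 → k) (g : C2) (i : Fin 6) :
    rep a (g • rel k i) = algebraMap k _ (shift a i) :=
  rep_freeScale_rel a (sgn_mul_self g) i

/-- Since `g` fixes each `rᵢ`, the twist in the fibres has no effect and `rᵢ` acts by the same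
scalar on every fibre. -/
theorem smashRep_rel {a : Fin 3 → k} {κ : relSpace k →ₗ[k] MonoidAlgebra k C2}
    (hκ : ∀ i, κ (relI k i) = algebraMap k _ (shift a i)) (r : relSpace k) :
    smashRep a (inclFree k r) = smashRep a (inclGroup k (κ r)) := by
  have h : (smashRep a).toLinearMap ∘ₗ (smashIncl k (Free4 k)).toLinearMap ∘ₗ
      (relSpace k).subtype =
      (smashRep a).toLinearMap ∘ₗ (inclGroup k).toLinearMap ∘ₗ κ := by
    refine relSpace_hom_ext fun i => ?_
    change smashRep a (single 1 (rel k i)) = smashRep a (inclGroup k (κ (relI k i)))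
    rw [hκ, AlgHom.commutes, AlgHom.commutes, smashRep_single, map_one, mul_one]
    refine LinearMap.ext fun φ => funext fun g => ?_
    rw [indRep_apply, rep_smul_rel]
    rfl
  exact LinearMap.congr_fun h r

theorem defMk_rel (κ : relSpace k →ₗ[k] MonoidAlgebra k C2) (i : Fin 6) :
    defMk k κ (single 1 (rel k i)) = defMk k κ (inclGroup k (κ (relI k i))) :=
  RingQuot.mkAlgHom_rel k (show DefRel k κ _ _ from ⟨relI k i, rfl, rfl⟩)

/-- The polynomials `ev a (x.coeff g)` detect the vanishing of `x` in `D_κ`. -/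
theorem defMk_eq_zero_iff {a : Fin 3 → k} {κ : relSpace k →ₗ[k] MonoidAlgebra k C2}
    (hκ : ∀ i, κ (relI k i) = algebraMap k _ (shift a i)) {x : Smash (Free4 k)} :
    defMk k κ x = 0 ↔ ∀ g, ev a (x.coeff g) = 0 := by
  constructor
  · intro h g
    have hrel : ∀ ⦃x y⦄, DefRel k κ x y → smashRep a x = smashRep a y := by
      rintro _ _ ⟨r, rfl, rfl⟩
      exact smashRep_rel hκ r
    have h1 : RingQuot.liftAlgHom k ⟨smashRep a, hrel⟩ (defMk k κ x) = smashRep a x :=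
      RingQuot.liftAlgHom_mkAlgHom_apply k _ _ x
    have h2 : smashRep a x = 0 := h1.symm.trans ((congrArg _ h).trans (map_zero _))
    have h3 : ev a (g⁻¹ • x.coeff g) = 0 := by
      rw [← smashRep_delta, h2]
      rfl
    -- Acting by `g` undoes the twist, because the kernel of `ev a` is stable under `C₂`.
    have h4 := ev_freeScale_eq_zero (sgn_mul_self g) h3
    rwa [← smul_free_def, smul_inv_smul] at h4
  · intro h
    have hφ : ∀ i, (defMk k κ).comp (smashIncl k (Free4 k)) (rel k i) =
        algebraMap k _ (shift a i) := fun i => by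
      change defMk k κ (single 1 (rel k i)) = _
      rw [defMk_rel, hκ, AlgHom.commutes, AlgHom.commutes]
    have hx : ∀ g, defMk k κ (single g (x.coeff g)) = 0 := fun g => by
      -- As `b # g = (b # 1)(1 # g)`, it suffices to kill the coefficient at the identity of the
      -- group.
      have h1 : defMk k κ (single 1 (x.coeff g)) = 0 := map_eq_zero_of_ev_eq_zero hφ (h g)
      have h2 : single g (x.coeff g) = single 1 (x.coeff g) * single g (1 : Free4 k) := by
        simp [SkewMonoidAlgebra.single_mul_single]
      rw [h2, map_mul, h1, zero_mul]
    have hsum := SkewMonoidAlgebra.sum_single x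
    rw [SkewMonoidAlgebra.sum_def'] at hsum
    refine (congrArg (defMk k κ) hsum.symm).trans ?_
    rw [_root_.map_sum]
    exact Finset.sum_eq_zero fun g _ => hx g

/-! ### Associated graded pieces -/

namespace AlgFiltration

variable {D : Type*} [Ring D] [Algebra k D] (Φ : AlgFiltration k D)

theorem prev_mul_mem {i j : ℕ} {x y : D} (hx : x ∈ Φ.prev i) (hy : y ∈ Φ.F j) :
    x * y ∈ Φ.prev (i + j) := by
  cases i with
  | zero =>
    rw [(Submodule.mem_bot k).mp hx, zero_mul]
    exact zero_mem _
  | succ i =>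
    rw [Nat.succ_add]
    exact Φ.mul_mem hx hy

theorem mul_prev_mem {i j : ℕ} {x y : D} (hx : x ∈ Φ.F i) (hy : y ∈ Φ.prev j) :
    x * y ∈ Φ.prev (i + j) := by
  cases j with
  | zero =>
    rw [(Submodule.mem_bot k).mp hy, mul_zero]
    exact zero_mem _
  | succ j => exact Φ.mul_mem hx hy

theorem symb_eq_symb_iff {n : ℕ} {x y : D} (hx : x ∈ Φ.F n) (hy : y ∈ Φ.F n) :
    Φ.symb x hx = Φ.symb y hy ↔ x - y ∈ Φ.prev n := by
  unfold symb
  rw [Submodule.Quotient.eq]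
  rfl

end AlgFiltration

section AssociatedGraded

variable (κ : relSpace k →ₗ[k] MonoidAlgebra k C2)

theorem defFiltration_prev (n : ℕ) : (defFiltration k κ).prev n =
    (smashSub (freeLT k n)).map (defMk k κ).toLinearMap := by
  cases n with
  | zero => simp [AlgFiltration.prev, freeLT]
  | succ n => rfl

theorem defMk_mem_F {n : ℕ} {x : Smash (Free4 k)} (hx : x ∈ smashSub (letters k ^ n)) :
    (defMk k κ).toLinearMap x ∈ (defFiltration k κ).F n :=
  ⟨x, smashSub_mono (letters_pow_le_freeLE le_rfl) hx, rfl⟩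

theorem smashEnvHom_mem {n : ℕ} {x : Smash (Free4 k)} (hx : x ∈ smashSub (letters k ^ n)) :
    (smashEnvHom k).toLinearMap x ∈ smashDeg k n := by
  rw [smashDeg_eq]
  exact ⟨x, hx, rfl⟩

/-- The map from the words of length `n` with coefficients in `kC₂` to the degree `n` part of the
associated graded algebra of `D_κ`. -/
def toGr (n : ℕ) : (smashSub (letters k ^ n) : Submodule k (Smash (Free4 k))) →ₗ[k]
    (defFiltration k κ).Gr n :=
  Submodule.mkQ _ ∘ₗ (defMk k κ).toLinearMap.restrict fun _ hx => defMk_mem_F κ hx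

theorem toGr_apply {n : ℕ} (x : (smashSub (letters k ^ n) : Submodule k (Smash (Free4 k)))) :
    toGr κ n x = (defFiltration k κ).symb (defMk k κ x) (defMk_mem_F κ x.2) := rfl

/-- The map from the words of length `n` with coefficients in `kC₂` to the degree `n` part of
`(A ⊗ Aᵒᵖ) # kC₂`. -/
def toSmashDeg (k : Type*) [CommRing k] (n : ℕ) :
    (smashSub (letters k ^ n) : Submodule k (Smash (Free4 k))) →ₗ[k] smashDeg k n :=
  (smashEnvHom k).toLinearMap.restrict fun _ hx => smashEnvHom_mem hx

theorem coe_toSmashDeg {n : ℕ} (x : (smashSub (letters k ^ n) : Submodule k (Smash (Free4 k)))) :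
    (toSmashDeg k n x : Smash (Env k)) = smashEnvHom k x := rfl

theorem toSmashDeg_surjective (n : ℕ) : Function.Surjective (toSmashDeg k n) := by
  rintro ⟨y, hy⟩
  rw [smashDeg_eq] at hy
  obtain ⟨x, hx, rfl⟩ := hy
  exact ⟨⟨x, hx⟩, rfl⟩

theorem toSmashDeg_eq_zero_iff {n : ℕ}
    {x : (smashSub (letters k ^ n) : Submodule k (Smash (Free4 k)))} :
    toSmashDeg k n x = 0 ↔ ∀ g, ev 0 ((x : Smash (Free4 k)).coeff g) = 0 := by
  rw [← smashEnvHom_eq_zero_iff, ← coe_toSmashDeg, ZeroMemClass.coe_eq_zero]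

theorem exists_leading_term {n : ℕ} {d : DefAlg k κ} (hd : d ∈ (defFiltration k κ).F n) :
    ∃ x : (smashSub (letters k ^ n) : Submodule k (Smash (Free4 k))),
      d - defMk k κ x ∈ (defFiltration k κ).prev n := by
  obtain ⟨z, hz, rfl⟩ := hd
  obtain ⟨x, hx, y, hy, rfl⟩ :=
    Submodule.mem_sup.mp (smashSub_sup _ _ (smashSub_mono (freeLE_le n) hz))
  refine ⟨⟨x, hx⟩, ?_⟩
  rw [defFiltration_prev]
  exact ⟨y, hy, by simp⟩

theorem toGr_surjective (n : ℕ) : Function.Surjective (toGr κ n) := by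
  intro z
  obtain ⟨⟨d, hd⟩, rfl⟩ := Submodule.Quotient.mk_surjective _ z
  obtain ⟨x, hx⟩ := exists_leading_term κ hd
  exact ⟨x, (((defFiltration k κ).symb_eq_symb_iff hd _).mpr hx).symm⟩

theorem toGr_eq_zero_iff {n : ℕ}
    {x : (smashSub (letters k ^ n) : Submodule k (Smash (Free4 k)))} :
    toGr κ n x = 0 ↔ defMk k κ x ∈ (defFiltration k κ).prev n := by
  have h := (defFiltration k κ).symb_eq_symb_iff (defMk_mem_F κ x.2) (zero_mem _)
  rw [toGr_apply]
  change _ = (defFiltration k κ).symb 0 _ ↔ _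
  rw [sub_zero] at h
  exact h

variable {κ} in
-- This is the core of the PBW property. If `x` agrees in `D_κ` with an element of lower degree,
-- then `ev a`, and hence `ev 0`, has degree below `n` on each coefficient; but `ev 0` is
-- homogeneous of degree `n` there, so it vanishes.
theorem toGr_eq_zero_iff_toSmashDeg_eq_zero {a : Fin 3 → k}
    (hκ : ∀ i, κ (relI k i) = algebraMap k _ (shift a i)) {n : ℕ}
    (x : (smashSub (letters k ^ n) : Submodule k (Smash (Free4 k)))) :
    toGr κ n x = 0 ↔ toSmashDeg k n x = 0 := by
  rw [toGr_eq_zero_iff, toSmashDeg_eq_zero_iff, defFiltration_prev]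
  constructor
  · rintro ⟨y, hy, hxy⟩ g
    have h1 : defMk k κ (x - y) = 0 := by
      rw [map_sub, sub_eq_zero]
      exact hxy.symm
    have h2 := (defMk_eq_zero_iff hκ).mp h1 g
    rw [SkewMonoidAlgebra.coeff_sub, Finsupp.sub_apply, map_sub, sub_eq_zero] at h2
    have h3 := ev_sub_ev_zero_mem_polyLT a (x.2 g)
    have h4 := ev_mem_polyLT a (hy g)
    refine eq_zero_of_mem_polyEQ_of_mem_polyLT (ev_zero_mem_polyEQ (x.2 g)) ?_
    rw [h2] at h3
    simpa using sub_mem h4 h3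
  · intro h
    -- The lower-degree representative is the normal form of each coefficient: its degree-`n` part
    -- is given by `ev 0`, which is zero.
    refine ⟨smashOf fun g => sec (ev a ((x : Smash (Free4 k)).coeff g)), fun g => ?_, ?_⟩
    · have h1 := ev_sub_ev_zero_mem_polyLT a (x.2 g)
      rw [h g, sub_zero] at h1
      exact sec_mem_freeLT h1
    · rw [AlgHom.toLinearMap_apply, ← sub_eq_zero, ← map_sub, defMk_eq_zero_iff hκ]
      intro g
      rw [SkewMonoidAlgebra.coeff_sub, Finsupp.sub_apply, coeff_smashOf, map_sub, sub_eq_zero]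
      exact LinearMap.congr_fun (map_sec_ev (rep_rel a) _) 1

/-! ### The grading of `(A ⊗ Aᵒᵖ) # kC₂` -/

theorem smashDeg_gradedMonoid : SetLike.GradedMonoid (smashDeg k) where
  one_mem := by
    rw [smashDeg_eq, ← map_one (smashEnvHom k)]
    exact ⟨1, one_mem_smashSub_letters_pow, rfl⟩
  mul_mem i j x y hx hy := by
    rw [smashDeg_eq] at hx hy ⊢
    obtain ⟨x, hx, rfl⟩ := hx
    obtain ⟨y, hy, rfl⟩ := hy
    exact ⟨x * y, mul_mem_smashSub_letters_pow hx hy, by simp⟩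

theorem smashSub_freeLE_le (n : ℕ) : (smashSub (freeLE k n) : Submodule k (Smash (Free4 k))) ≤
    ⨆ i, smashSub (letters k ^ i) := by
  induction n with
  | zero =>
    have h : freeLE k 0 ≤ letters k ^ 0 := by simp [freeLE]
    exact (smashSub_mono h).trans
      (le_iSup (fun i => (smashSub (letters k ^ i) : Submodule k (Smash (Free4 k)))) 0)
  | succ n ih =>
    exact (smashSub_mono (freeLE_le _)).trans ((smashSub_sup _ _).trans
      (sup_le (le_iSup (fun i => (smashSub (letters k ^ i) : Submodule k (Smash (Free4 k))))
        (n + 1)) ih))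

theorem iSup_smashDeg : ⨆ n, smashDeg k n = ⊤ := by
  rw [eq_top_iff]
  rintro y -
  obtain ⟨x, rfl⟩ := smashEnvHom_surjective y
  choose N hN using fun g => exists_mem_freeLE k (x.coeff g)
  have hx : x ∈ (smashSub (freeLE k (Finset.univ.sup N)) : Submodule k (Smash (Free4 k))) :=
    fun g => freeLE_mono k (Finset.le_sup (Finset.mem_univ g)) (hN g)
  have h := Submodule.mem_map_of_mem (f := (smashEnvHom k).toLinearMap) (smashSub_freeLE_le _ hx)
  rw [Submodule.map_iSup] at h
  simp_rw [smashDeg_eq]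
  exact h

theorem eq_zero_of_sum_polyEQ {ι : Type*} [DecidableEq ι] {d : ι → ℕ} (hd : Function.Injective d)
    (s : Finset ι) (p : ι → Poly4 k) (hp : ∀ i, p i ∈ polyEQ k (d i)) (h : ∑ i ∈ s, p i = 0) :
    ∀ i ∈ s, p i = 0 := by
  intro i hi
  ext m
  rw [MvPolynomial.coeff_zero]
  by_contra hm
  have hdeg : ∀ j, MvPolynomial.coeff m (p j) ≠ 0 → m.degree = d j := fun j hj =>
    (mem_restrictSupport_iff (r := p j)).1 (hp j) (mem_support_iff.mpr hj)
  have h1 := congrArg (MvPolynomial.coeff m) h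
  rw [MvPolynomial.coeff_sum, MvPolynomial.coeff_zero, Finset.sum_eq_single_of_mem i hi] at h1
  · exact hm h1
  · intro j _ hj
    by_contra hmj
    exact hj (hd ((hdeg j hmj).symm.trans (hdeg i hm)))

/-- Independence is read off through `ev 0`: a vanishing sum of components gives, for each group
element, a vanishing sum of homogeneous polynomials of distinct degrees. -/
theorem smashDeg_isInternal : DirectSum.IsInternal (smashDeg k) := by
  classical
  rw [DirectSum.isInternal_submodule_iff_iSupIndep_and_iSup_eq_top]
  refine ⟨?_, iSup_smashDeg⟩
  refine iSupIndep_of_dfinsupp_lsum_injective _ ?_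
  rw [injective_iff_map_eq_zero]
  intro z hz
  choose x hx using fun n => toSmashDeg_surjective n (z n)
  have hsum : smashEnvHom k (∑ n ∈ z.support, (x n : Smash (Free4 k))) = 0 := by
    rw [_root_.map_sum, ← hz, DFinsupp.lsum_apply_apply, DFinsupp.sumAddHom_apply,
      DFinsupp.sum]
    exact Finset.sum_congr rfl fun n _ => congrArg Subtype.val (hx n)
  rw [smashEnvHom_eq_zero_iff] at hsum
  ext1 n
  by_cases hn : n ∈ z.support
  · rw [← hx n, DFinsupp.zero_apply, toSmashDeg_eq_zero_iff]
    intro g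
    have hcoeff : (∑ n ∈ z.support, (x n : Smash (Free4 k))).coeff g =
        ∑ n ∈ z.support, (x n : Smash (Free4 k)).coeff g := by
      let c : Smash (Free4 k) →+ Free4 k :=
        { toFun := fun y => y.coeff g, map_zero' := rfl, map_add' := fun y z => by simp }
      exact _root_.map_sum c _ _
    have h := hsum g
    rw [hcoeff, _root_.map_sum] at h
    exact eq_zero_of_sum_polyEQ Function.injective_id _
      (fun n => ev 0 ((x n : Smash (Free4 k)).coeff g))
      (fun n => ev_zero_mem_polyEQ ((x n).2 g)) h n hn
  · rwa [DFinsupp.notMem_support_iff] at hn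

/-! ### The graded isomorphism -/

variable {κ} in
theorem ker_toGr {a : Fin 3 → k} (hκ : ∀ i, κ (relI k i) = algebraMap k _ (shift a i)) (n : ℕ) :
    LinearMap.ker (toGr κ n) = LinearMap.ker (toSmashDeg k n) :=
  Submodule.ext fun x => toGr_eq_zero_iff_toSmashDeg_eq_zero hκ x

variable {κ} in
/-- The degree `n` part of the isomorphism between the associated graded algebra of `D_κ` and
`(A ⊗ Aᵒᵖ) # kC₂`. -/
def grEquiv {a : Fin 3 → k} (hκ : ∀ i, κ (relI k i) = algebraMap k _ (shift a i)) (n : ℕ) :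
    (defFiltration k κ).Gr n ≃ₗ[k] smashDeg k n :=
  ((toGr κ n).quotKerEquivOfSurjective (toGr_surjective κ n)).symm ≪≫ₗ
    Submodule.quotEquivOfEq _ _ (ker_toGr hκ n) ≪≫ₗ
    (toSmashDeg k n).quotKerEquivOfSurjective (toSmashDeg_surjective n)

variable {κ} in
theorem grEquiv_toGr {a : Fin 3 → k} (hκ : ∀ i, κ (relI k i) = algebraMap k _ (shift a i)) {n : ℕ}
    (x : (smashSub (letters k ^ n) : Submodule k (Smash (Free4 k)))) :
    grEquiv hκ n (toGr κ n x) = toSmashDeg k n x := by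
  have h : ((toGr κ n).quotKerEquivOfSurjective (toGr_surjective κ n)).symm (toGr κ n x) =
      Submodule.Quotient.mk x := by
    rw [LinearEquiv.symm_apply_eq]
    rfl
  rw [grEquiv, LinearEquiv.trans_apply, LinearEquiv.trans_apply, h]
  rfl

variable {κ} in
theorem grEquiv_symb {a : Fin 3 → k} (hκ : ∀ i, κ (relI k i) = algebraMap k _ (shift a i)) {n : ℕ}
    {d : DefAlg k κ} (hd : d ∈ (defFiltration k κ).F n) {x : Smash (Free4 k)}
    (hx : x ∈ smashSub (letters k ^ n)) (h : d - defMk k κ x ∈ (defFiltration k κ).prev n) :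
    (grEquiv hκ n ((defFiltration k κ).symb d hd) : Smash (Env k)) = smashEnvHom k x := by
  rw [((defFiltration k κ).symb_eq_symb_iff hd (defMk_mem_F κ hx)).mpr h]
  exact congrArg Subtype.val (grEquiv_toGr hκ ⟨x, hx⟩)

variable {κ} in
/-- The algebras `D_κ` for the listed `κ` are PBW deformations. -/
theorem isPBWDeformation {a : Fin 3 → k}
    (hκ : ∀ i, κ (relI k i) = algebraMap k _ (shift a i)) :
    IsPBWDeformation (defFiltration k κ) (smashDeg k) := by
  refine ⟨⟨smashDeg_gradedMonoid, smashDeg_isInternal⟩, grEquiv hκ, ?_, ?_⟩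
  · rw [grEquiv_symb hκ _ one_mem_smashSub_letters_pow, map_one]
    rw [map_one, sub_self]
    exact zero_mem _
  · intro i j d d' hd hd'
    obtain ⟨x, hx⟩ := exists_leading_term κ hd
    obtain ⟨y, hy⟩ := exists_leading_term κ hd'
    rw [grEquiv_symb hκ hd x.2 hx, grEquiv_symb hκ hd' y.2 hy,
      grEquiv_symb hκ _ (mul_mem_smashSub_letters_pow x.2 y.2), map_mul]
    -- With `x`, `y` read in `D_κ`, `d d' - x y = (d - x) d' + x (d' - y)`, so the product of
    -- leading terms is a leading term of the product.
    have h := add_mem ((defFiltration k κ).prev_mul_mem hx hd')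
      ((defFiltration k κ).mul_prev_mem (defMk_mem_F κ x.2) hy)
    rw [map_mul]
    convert h using 1
    rw [AlgHom.toLinearMap_apply]
    noncomm_ring

end AssociatedGraded

/-! ### Necessity -/

section Overlaps

/-- The coefficient of the word `x y` in an element of the free algebra. -/
def quadCoeff (k : Type*) [CommRing k] (x y : Gen4) : Free4 k →ₗ[k] k :=
  Matrix.entryLinearMap k k (0 : Fin 3) (2 : Fin 3) ∘ₗ
    (FreeAlgebra.lift k fun z =>
      !![0, if z = x then (1 : k) else 0, 0; 0, 0, if z = y then 1 else 0; 0, 0, 0]).toLinearMap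

/-- Letters become strictly upper triangular matrices, and the corner entry of a product of two of
them sees only first letter `x` followed by second letter `y`. -/
theorem quadCoeff_mul (x y z w : Gen4) :
    quadCoeff k x y (FreeAlgebra.ι k z * FreeAlgebra.ι k w) =
      if z = x then if w = y then 1 else 0 else 0 := by
  simp only [quadCoeff, LinearMap.comp_apply, AlgHom.toLinearMap_apply, map_mul,
    FreeAlgebra.lift_ι_apply, Matrix.entryLinearMap_apply]
  rw [Matrix.mul_apply, Fin.sum_univ_three]
  by_cases hz : z = x <;> simp [hz]

/-- The linear map `κ` with prescribed scalar values on `r₁`, `r₂`, `r₃`. -/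
def kappa (a : Fin 3 → k) : relSpace k →ₗ[k] MonoidAlgebra k C2 :=
  Algebra.linearMap k (MonoidAlgebra k C2) ∘ₗ
    (a 0 • quadCoeff k Gen4.v Gen4.u + a 1 • quadCoeff k Gen4.v' Gen4.u' +
      a 2 • quadCoeff k Gen4.u Gen4.u') ∘ₗ (relSpace k).subtype

/-- The words `vu`, `v'u'` and `uu'` occur with coefficient one in `r₁`, `r₂` and `r₃` respectively,
and in no other relation. -/
theorem kappa_relI (a : Fin 3 → k) (i : Fin 6) :
    kappa a (relI k i) = algebraMap k _ (shift a i) := by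
  rw [kappa, LinearMap.comp_apply, Algebra.linearMap_apply]
  congr 1
  fin_cases i <;> simp [relI, rel, shift, pow_two, quadCoeff_mul]

theorem ι_mem_letters (x : Gen4) : FreeAlgebra.ι k x ∈ letters k := Submodule.subset_span ⟨x, rfl⟩

theorem sec_ev_of_mem_letters {x : Free4 k} (hx : x ∈ letters k) : sec (ev 0 x) = x := by
  have h : letters k ≤ LinearMap.eqLocus (sec ∘ₗ ev 0) LinearMap.id := by
    unfold letters
    rw [Submodule.span_le]
    rintro _ ⟨x, rfl⟩
    have h1 : ev 0 (FreeAlgebra.ι k x) = monomial (Finsupp.single x 1) 1 := by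
      rw [ev_apply, rep_ι]
      cases x <;> simp [opGen_u, opGen_v, opGen_u', opGen_v', X]
    rw [SetLike.mem_coe, LinearMap.mem_eqLocus, LinearMap.comp_apply, h1, sec_monomial]
    cases x <;> simp [word]
  exact h hx

/-- The relations are quadratic, so nothing collapses in degree one: a linear element is its own
normal form. -/
theorem toSmashDeg_one_injective : Function.Injective (toSmashDeg k 1) := by
  rw [injective_iff_map_eq_zero]
  intro x hx
  rw [toSmashDeg_eq_zero_iff] at hx
  ext1
  refine SkewMonoidAlgebra.ext fun g => ?_
  have h := sec_ev_of_mem_letters (by simpa using x.2 g)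
  rw [hx g, map_zero] at h
  exact h.symm

theorem coeff_inclGroup (m : MonoidAlgebra k C2) (g : C2) :
    (inclGroup k m).coeff g = algebraMap k (Free4 k) (m.coeff g) := by
  induction m using MonoidAlgebra.induction_on with
  | of h =>
    have h1 : inclGroup k (MonoidAlgebra.of k C2 h) = single h 1 :=
      MonoidAlgebra.lift_of (SkewMonoidAlgebra.of (Free4 k) C2) h
    rw [h1, SkewMonoidAlgebra.coeff_single_apply, MonoidAlgebra.of_apply,
      MonoidAlgebra.coeff_single, Finsupp.single_apply]
    split_ifs <;> simp
  | add x y hx hy => simp [hx, hy]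
  | smul r x hx =>
    rw [map_smul, SkewMonoidAlgebra.coeff_smul, Finsupp.smul_apply, hx,
      MonoidAlgebra.coeff_smul, Finsupp.smul_apply, smul_eq_mul, map_mul, Algebra.smul_def]

theorem coeff_inclGroup_mul (m : MonoidAlgebra k C2) (x : Free4 k) (g : C2) :
    (inclGroup k m * single 1 x).coeff g = m.coeff g • g • x := by
  rw [SkewMonoidAlgebra.coeff_mul_single, inv_one, mul_one, coeff_inclGroup, Algebra.smul_def]

theorem coeff_mul_inclGroup (m : MonoidAlgebra k C2) (x : Free4 k) (g : C2) :
    (single 1 x * inclGroup k m).coeff g = m.coeff g • x := by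
  rw [SkewMonoidAlgebra.coeff_single_one_mul, coeff_inclGroup, Algebra.smul_def, Algebra.commutes]

theorem smul_of_mem_letters (g : C2) {x : Free4 k} (hx : x ∈ letters k) :
    g • x = sgn k g • x := by
  have h : letters k ≤ LinearMap.eqLocus (freeScale k Gen4 (sgn k g)).toLinearMap
      (sgn k g • LinearMap.id) := by
    unfold letters
    rw [Submodule.span_le]
    rintro _ ⟨x, rfl⟩
    exact freeScale_ι k Gen4 (sgn k g) x
  exact h hx

/-! ### Overlap conditions -/

/-- A syzygy between the relations constrains those `κ` for which the words of length one stay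
independent in `D_κ`. -/
theorem overlap_condition {κ : relSpace k →ₗ[k] MonoidAlgebra k C2}
    (hinj : ∀ x ∈ (smashSub (letters k ^ 1) : Submodule k (Smash (Free4 k))),
      defMk k κ x = 0 → x = 0)
    {c d : Fin 6 → Free4 k} (hc : ∀ i, c i ∈ letters k) (hd : ∀ i, d i ∈ letters k)
    (h : ∑ i, rel k i * c i = ∑ i, d i * rel k i) (g : C2) :
    ∑ i, (κ (relI k i)).coeff g • (sgn k g • c i - d i) = 0 := by
  let z : Smash (Free4 k) := ∑ i, (inclGroup k (κ (relI k i)) * single 1 (c i) -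
    single 1 (d i) * inclGroup k (κ (relI k i)))
  have hz : ∀ g, z.coeff g = ∑ i, (κ (relI k i)).coeff g • (sgn k g • c i - d i) := fun g => by
    let f : Smash (Free4 k) →+ Free4 k :=
      { toFun := fun y => y.coeff g, map_zero' := rfl, map_add' := fun y z => by simp }
    refine (_root_.map_sum f _ _).trans (Finset.sum_congr rfl fun i _ => ?_)
    change (_ - _ : Smash (Free4 k)).coeff g = _
    rw [SkewMonoidAlgebra.coeff_sub, Finsupp.sub_apply, coeff_inclGroup_mul, coeff_mul_inclGroup,
      smul_sub, smul_of_mem_letters g (hc i)]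
  have hmem : z ∈ (smashSub (letters k ^ 1) : Submodule k (Smash (Free4 k))) := fun g => by
    rw [hz, pow_one]
    exact sum_mem fun i _ => Submodule.smul_mem _ _
      (sub_mem (Submodule.smul_mem _ _ (hc i)) (hd i))
  have hzero : defMk k κ z = 0 := by
    -- In `D_κ` each `rᵢ` on either side of the syzygy may be replaced by `κ(rᵢ)`; the difference of
    -- the two sides is the image of `z`.
    have h1 := congrArg ((defMk k κ).comp (smashIncl k (Free4 k))) h
    rw [_root_.map_sum, _root_.map_sum] at h1
    simp only [map_mul, AlgHom.comp_apply, smashIncl_apply, defMk_rel] at h1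
    simp only [z, _root_.map_sum, map_sub, map_mul, Finset.sum_sub_distrib, h1, sub_self]
  rw [← hz, hinj z hmem hzero]
  rfl

theorem sgn_of_ne_one {g : C2} (hg : g ≠ 1) : sgn k g = -1 := if_neg hg

/-- The coefficient of a letter in an element of the free algebra. -/
def letterCoeff (k : Type*) [CommRing k] (x : Gen4) : Free4 k →ₐ[k] k :=
  FreeAlgebra.lift k fun y => if y = x then 1 else 0

@[simp] theorem letterCoeff_ι (x y : Gen4) :
    letterCoeff k x (FreeAlgebra.ι k y) = if y = x then 1 else 0 :=
  FreeAlgebra.lift_ι_apply _ _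

theorem overlap_condition_coeff {κ : relSpace k →ₗ[k] MonoidAlgebra k C2}
    (hinj : ∀ x ∈ (smashSub (letters k ^ 1) : Submodule k (Smash (Free4 k))),
      defMk k κ x = 0 → x = 0)
    {c d : Fin 6 → Free4 k} (hc : ∀ i, c i ∈ letters k) (hd : ∀ i, d i ∈ letters k)
    (h : ∑ i, rel k i * c i = ∑ i, d i * rel k i) (g : C2) (x : Gen4) :
    ∑ i, (κ (relI k i)).coeff g * (sgn k g * letterCoeff k x (c i) - letterCoeff k x (d i)) = 0 := by
  have h1 := congrArg (letterCoeff k x) (overlap_condition hinj hc hd h g)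
  simpa only [_root_.map_sum, map_smul, map_sub, smul_eq_mul, map_zero] using h1

/-- The three syzygies involve the letter triples `u, v, u'`; `u, v, v'`; and `u, u', v'`. At `g ≠
1` the sign makes the coefficients `-(cᵢ + dᵢ)`, which are multiples of `2` times distinct letters,
so every `κ(rᵢ)` occurring vanishes at `g`. At `g = 1` the coefficients are `cᵢ - dᵢ`, which is
nonzero for just one `i` in each syzygy: `r₄`, `r₆` and `r₅` in turn. -/
theorem kappa_conditions [NoZeroDivisors k] (hk : (2 : k) ≠ 0)
    {κ : relSpace k →ₗ[k] MonoidAlgebra k C2}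
    (hinj : ∀ x ∈ (smashSub (letters k ^ 1) : Submodule k (Smash (Free4 k))),
      defMk k κ x = 0 → x = 0) :
    (∀ g ≠ 1, ∀ i, (κ (relI k i)).coeff g = 0) ∧ (κ (relI k 3)).coeff 1 = 0 ∧
      (κ (relI k 4)).coeff 1 = 0 ∧ (κ (relI k 5)).coeff 1 = 0 := by
  obtain ⟨u, hu⟩ : ∃ u, u = FreeAlgebra.ι k Gen4.u := ⟨_, rfl⟩
  obtain ⟨v, hv⟩ : ∃ v, v = FreeAlgebra.ι k Gen4.v := ⟨_, rfl⟩
  obtain ⟨u', hu'⟩ : ∃ u', u' = FreeAlgebra.ι k Gen4.u' := ⟨_, rfl⟩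
  obtain ⟨v', hv'⟩ : ∃ v', v' = FreeAlgebra.ι k Gen4.v' := ⟨_, rfl⟩
  have mu : u ∈ letters k := hu ▸ ι_mem_letters _
  have mv : v ∈ letters k := hv ▸ ι_mem_letters _
  have mu' : u' ∈ letters k := hu' ▸ ι_mem_letters _
  have mv' : v' ∈ letters k := hv' ▸ ι_mem_letters _
  have h1 := overlap_condition_coeff hinj (c := ![u', 0, v, -u - v, 0, 0])
    (d := ![u', 0, v, -u + v, 0, 0])
    (fun i => by fin_cases i <;> simp [mu, mv, mu', sub_mem])
    (fun i => by fin_cases i <;> simp [mu, mv, mu', add_mem])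
    (by
      simp [Fin.sum_univ_succ, rel, ← hu, ← hv, ← hu', ← hv']
      noncomm_ring)
  have h2 := overlap_condition_coeff hinj (c := ![v', 0, 0, 0, v, -u - v])
    (d := ![v', 0, 0, 0, v, -u + v])
    (fun i => by fin_cases i <;> simp [mu, mv, mv', sub_mem])
    (fun i => by fin_cases i <;> simp [mu, mv, mv', add_mem])
    (by
      simp [Fin.sum_univ_succ, rel, ← hu, ← hv, ← hu', ← hv']
      noncomm_ring)
  have h3 := overlap_condition_coeff hinj (c := ![0, u, -v', 0, u' - v', 0])
    (d := ![0, u, -v', 0, u' + v', 0])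
    (fun i => by fin_cases i <;> simp [mu, mu', mv', sub_mem])
    (fun i => by fin_cases i <;> simp [mu, mu', mv', add_mem])
    (by
      simp [Fin.sum_univ_succ, rel, ← hu, ← hv, ← hu', ← hv']
      noncomm_ring)
  have hneg : ((-1 : k) - 1) ≠ 0 := fun h => hk (by linear_combination -h)
  have hneg' : ((1 : k) + 1) ≠ 0 := fun h => hk (by linear_combination h)
  refine ⟨fun g hg => ?_, ?_⟩
  · have h1u := h1 g Gen4.u
    have h1v := h1 g Gen4.v
    have h1u' := h1 g Gen4.u'
    have h2u := h2 g Gen4.u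
    have h2v := h2 g Gen4.v
    have h3u := h3 g Gen4.u
    simp [Fin.sum_univ_succ, sgn_of_ne_one hg, hu, hv, hu', hv', hneg, hneg'] at h1u h1v h1u' h2u h2v h3u
    intro i
    fin_cases i
    exacts [h1u', h3u, h1v, h1u, h2v, h2u]
  · have h1v := h1 1 Gen4.v
    have h2v := h2 1 Gen4.v
    have h3v' := h3 1 Gen4.v'
    simp [Fin.sum_univ_succ, hu, hv, hu', hv', hneg] at h1v h2v h3v'
    exact ⟨h1v, h3v', h2v⟩

end Overlaps

end CommRing

section Field

variable {k : Type*} [Field k]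

/-! ### The dimension count in degree one -/

theorem letters_finiteDimensional (n : ℕ) : Module.Finite k (letters k ^ n : Submodule k _) := by
  rw [Module.Finite.iff_fg]
  exact (Submodule.fg_span (Set.finite_range _)).pow n

theorem smashSub_finiteDimensional {B : Type*} [Ring B] [Algebra k B] (S : Submodule k B)
    [Module.Finite k S] : Module.Finite k (smashSub S : Submodule k (Smash B)) := by
  let f : (smashSub S : Submodule k (Smash B)) →ₗ[k] C2 → S :=
    { toFun := fun x g => ⟨(x : Smash B).coeff g, x.2 g⟩
      map_add' := fun x y => by ext; simp
      map_smul' := fun c x => by ext; simp }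
  refine Module.Finite.of_injective f fun x y h => ?_
  ext1
  exact SkewMonoidAlgebra.ext fun g => congrArg Subtype.val (congrFun h g)

/-- In a PBW deformation, the words of length one stay independent. -/
theorem toGr_one_injective {κ : relSpace k →ₗ[k] MonoidAlgebra k C2}
    (h : IsPBWDeformation (defFiltration k κ) (smashDeg k)) : Function.Injective (toGr κ 1) := by
  obtain ⟨-, e, -⟩ := h
  have := letters_finiteDimensional (k := k) 1
  have := smashSub_finiteDimensional (letters k ^ 1)
  let ψ := LinearEquiv.ofBijective (toSmashDeg k 1)
    ⟨toSmashDeg_one_injective, toSmashDeg_surjective 1⟩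
  -- The given isomorphism `e` need not respect the letters. Its existence still makes `T` a
  -- surjective endomorphism of a finite-dimensional space, hence injective.
  let T : Module.End k (smashSub (letters k ^ 1) : Submodule k (Smash (Free4 k))) :=
    ψ.symm.toLinearMap ∘ₗ (e 1).toLinearMap ∘ₗ toGr κ 1
  have hT : Function.Surjective T :=
    ψ.symm.surjective.comp ((e 1).surjective.comp (toGr_surjective κ 1))
  have hT' : Function.Injective T := LinearMap.injective_iff_surjective.mpr hT
  exact fun x y hxy => hT' (congrArg (fun z => ψ.symm (e 1 z)) hxy)

theorem exists_of_isPBWDeformation (hk : (2 : k) ≠ 0) {κ : relSpace k →ₗ[k] MonoidAlgebra k C2}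
    (h : IsPBWDeformation (defFiltration k κ) (smashDeg k)) :
    ∃ a : Fin 3 → k, ∀ i, κ (relI k i) = algebraMap k _ (shift a i) := by
  have hinj : ∀ x ∈ (smashSub (letters k ^ 1) : Submodule k (Smash (Free4 k))),
      defMk k κ x = 0 → x = 0 := fun x hx h0 => by
    have h1 : toGr κ 1 ⟨x, hx⟩ = 0 := by
      rw [toGr_eq_zero_iff]
      change defMk k κ x ∈ _
      rw [h0]
      exact zero_mem _
    exact congrArg Subtype.val ((map_eq_zero_iff _ (toGr_one_injective h)).mp h1)
  obtain ⟨hg, h3, h4, h5⟩ := kappa_conditions hk hinj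
  refine ⟨![(κ (relI k 0)).coeff 1, (κ (relI k 1)).coeff 1, (κ (relI k 2)).coeff 1], fun i => ?_⟩
  have hi : κ (relI k i) = algebraMap k _ ((κ (relI k i)).coeff 1) := by
    ext g
    rw [MonoidAlgebra.coe_algebraMap, Function.comp_apply, MonoidAlgebra.coeff_single,
      Finsupp.single_apply]
    split_ifs with h1
    · rw [← h1]
      rfl
    · exact hg g (Ne.symm h1) i
  rw [hi]
  fin_cases i <;> simp [shift, h3, h4, h5]

end Field

theorem forall_shift_iff {k : Type*} [CommRing k] (κ : relSpace k →ₗ[k] MonoidAlgebra k C2)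
    (α₁ α₂ α₃ : k) :
    (∀ i, κ (relI k i) = algebraMap k _ (shift ![α₁, α₂, α₃] i)) ↔
      κ (relI k 0) = algebraMap k _ α₁ ∧ κ (relI k 1) = algebraMap k _ α₂ ∧
      κ (relI k 2) = algebraMap k _ α₃ ∧
      κ (relI k 3) = 0 ∧ κ (relI k 4) = 0 ∧ κ (relI k 5) = 0 := by
  simp [Fin.forall_fin_succ, shift]

end JordanPBW

end

open JordanPBW in
theorem proposition5p2 (k : Type*) [Field k] (hk : (2 : k) ≠ 0) :
    (∃ e : Presented k ≃ₐ[k] JordanPlane k ⊗[k] (JordanPlane k)ᵐᵒᵖ,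
      e (presGen k Gen4.u) = jgen k Gen2.u ⊗ₜ[k] 1 ∧
      e (presGen k Gen4.v) = jgen k Gen2.v ⊗ₜ[k] 1 ∧
      e (presGen k Gen4.u') = 1 ⊗ₜ[k] MulOpposite.op (jgen k Gen2.u) ∧
      e (presGen k Gen4.v') = 1 ⊗ₜ[k] MulOpposite.op (jgen k Gen2.v)) ∧
    (∀ α₁ α₂ α₃ : k, ∃! κ : relSpace k →ₗ[k] MonoidAlgebra k C2,
      κ (relI k 0) = algebraMap k _ α₁ ∧ κ (relI k 1) = algebraMap k _ α₂ ∧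
      κ (relI k 2) = algebraMap k _ α₃ ∧
      κ (relI k 3) = 0 ∧ κ (relI k 4) = 0 ∧ κ (relI k 5) = 0) ∧
    (∀ κ : relSpace k →ₗ[k] MonoidAlgebra k C2,
      IsPBWDeformation (defFiltration k κ) (smashDeg k) ↔
        ∃ α₁ α₂ α₃ : k,
          κ (relI k 0) = algebraMap k _ α₁ ∧ κ (relI k 1) = algebraMap k _ α₂ ∧
          κ (relI k 2) = algebraMap k _ α₃ ∧
          κ (relI k 3) = 0 ∧ κ (relI k 4) = 0 ∧ κ (relI k 5) = 0) := by
  refine ⟨⟨presEquivEnv k, presEquivEnv_presGen _, presEquivEnv_presGen _,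
    presEquivEnv_presGen _, presEquivEnv_presGen _⟩, fun α₁ α₂ α₃ => ?_, fun κ => ?_⟩
  · simp only [← forall_shift_iff]
    exact ⟨kappa ![α₁, α₂, α₃], kappa_relI _,
      fun κ hκ => relSpace_hom_ext fun i => (hκ i).trans (kappa_relI _ i).symm⟩
  · simp only [← forall_shift_iff]
    constructor
    · intro h
      obtain ⟨a, ha⟩ := exists_of_isPBWDeformation hk h
      refine ⟨a 0, a 1, a 2, fun i => ?_⟩
      rw [ha]
      rfl
    · rintro ⟨α₁, α₂, α₃, h⟩
      exact isPBWDeformation h
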